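/- **Theorem (explicit signs of correlations; Shen–Qiu–Tian).** Let $\Lambda$ be a finite set of sites with $|\Lambda|$ even. For $x\in\Lambda$ and $\sigma\in\{\uparrow,\downarrow\}$ let $c^\dagger_{x,\sigma}$, $c_{x,\sigma}$ be the fermionic creation and annihilation operators on the $4^{|\Lambda|}$-dimensional Fock space of electrons on $\Lambda$, satisfying the canonical anticommutation relations, and put $n_{x,\sigma}=c^\dagger_{x,\sigma}c_{x,\sigma}$. Let $t_{x,y}=t_{y,x}\in\mathbb R$ $(x,y\in\Lambda)$ and $U>0$, and consider the Hubbard Hamiltonian $$H=\sum_{x,y\in\Lambda}\sum_{\sigma=\uparrow,\downarrow}t_{x,y}\,c^\dagger_{x,\sigma}c_{y,\sigma}+U\sum_{x\in\Lambda}n_{x,\uparrow}n_{x,\downarrow}.$$ Assume that the model is bipartite, i.e. $\Lambda=A\cup B$ with $A\cap B=\emptyset$ and $t_{x,y}=0$ whenever $x,y\in A$ or $x,y\in B$, and that $\Lambda$ is connected through nonvanishing $t_{x,y}$, i.e. for any $x,y\in\Lambda$ there are sites $x=x_0,x_1,\dots,x_N=y$ with $t_{x_i,x_{i+1}}\neq0$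 for $0\le i<N$. For $\alpha=1,2,3$ let $\hat S^{(\alpha)}_x=\frac12\sum_{\sigma,\tau}c^\dagger_{x,\sigma}(p^{(\alpha)})_{\sigma,\tau}c_{x,\tau}$, where $p^{(\alpha)}$ are the Pauli matrices, and let $\hat{\mathbf S}_x\cdot\hat{\mathbf S}_y=\sum_{\alpha=1}^3\hat S^{(\alpha)}_x\hat S^{(\alpha)}_y$. Let $\Phi_{\rm GS}\neq0$ be any ground state at half filling, i.e. an eigenvector of $H$ in the space of states with exactly $|\Lambda|$ electrons whose eigenvalue is the lowest eigenvalue of $H$ in that space. Then for all $x,y\in\Lambda$ the number $\langle\Phi_{\rm GS},\hat{\mathbf S}_x\cdot\hat{\mathbf S}_y\,\Phi_{\rm GS}\rangle$ is real, and $$\langle\Phi_{\rm GS},\hat{\mathbf S}_x\cdot\hat{\mathbf S}_y\,\Phi_{\rm GS}\rangle\ \begin{cases}>0&\text{when }x,y\in A\text{ or }x,y\in B,\\<0&\text{when }x\in A,\ y\in B,\text{ or }x\in B,\ y\in A.\end{cases}$$ -/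

import Mathlib

open scoped ComplexOrder

noncomputable section

namespace Hubbard

/-- An electron configuration on the sites `Λ`: for each spin `σ` (`0` is up, `1` is down), the
set `S σ` of the sites which are occupied by an electron of spin `σ`. -/
abbrev Config (Λ : Type*) := Fin 2 → Finset Λ

/-- The fermionic Fock space over the single-electron states `(σ, x)`. It has dimension
`4 ^ |Λ|`, and its orthonormal basis is indexed by the configurations. The basis vector of `S` is
`∏_{x ∈ S 0} c†_{x,↑} ∏_{x ∈ S 1} c†_{x,↓} Φ_vac`, both products in increasing order. -/
abbrev Fock (Λ : Type*) := EuclideanSpace ℂ (Config Λ)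

variable {Λ : Type*} [Fintype Λ] [LinearOrder Λ]

/-- The number of electrons of `S` in single-electron states that precede `(σ, x)`, where all the
up states precede all the down states. -/
def numBefore (S : Config Λ) (σ : Fin 2) (x : Λ) : ℕ :=
  ∑ τ ∈ Finset.univ.filter (fun τ : Fin 2 => τ < σ), (S τ).card +
    ((S σ).filter (fun z => z < x)).card

/-- The creation operator `c†_{x,σ}`. It sends the basis vector of `S` to zero if `(σ, x)` is
occupied, and otherwise to `(-1) ^ numBefore S σ x` times the basis vector of `S ∪ {(σ, x)}`. -/
def create (x : Λ) (σ : Fin 2) : Module.End ℂ (Fock Λ) :=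
  Matrix.toEuclideanLin (Matrix.of fun T S : Config Λ =>
    if x ∉ S σ ∧ T = Function.update S σ (insert x (S σ)) then
      (-1 : ℂ) ^ numBefore S σ x
    else 0)

/-- The annihilation operator `c_{x,σ}`, the adjoint of `c†_{x,σ}`. -/
def annihilate (x : Λ) (σ : Fin 2) : Module.End ℂ (Fock Λ) :=
  LinearMap.adjoint (create x σ)

/-- The number operator `n_{x,σ} = c†_{x,σ} c_{x,σ}`. -/
def number (x : Λ) (σ : Fin 2) : Module.End ℂ (Fock Λ) :=
  create x σ * annihilate x σ

/-- The total number operator. -/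
def totalNumber (Λ : Type*) [Fintype Λ] [LinearOrder Λ] : Module.End ℂ (Fock Λ) :=
  ∑ x : Λ, (number x 0 + number x 1)

/-- The hopping Hamiltonian `∑_{x,y} ∑_σ t_{x,y} c†_{x,σ} c_{y,σ}`. -/
def hopping (t : Λ → Λ → ℝ) : Module.End ℂ (Fock Λ) :=
  ∑ x : Λ, ∑ y : Λ, ∑ σ : Fin 2, (t x y : ℂ) • (create x σ * annihilate y σ)

/-- The interaction Hamiltonian `∑_x U_x n_{x,↑} n_{x,↓}`. -/
def interaction (U : Λ → ℝ) : Module.End ℂ (Fock Λ) :=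
  ∑ x : Λ, (U x : ℂ) • (number x 0 * number x 1)

/-- The Hubbard Hamiltonian. -/
def hamiltonian (t : Λ → Λ → ℝ) (U : Λ → ℝ) : Module.End ℂ (Fock Λ) :=
  hopping t + interaction U

/-- The Pauli matrices. -/
def pauli : Fin 3 → Matrix (Fin 2) (Fin 2) ℂ :=
  ![!![0, 1; 1, 0], !![0, -Complex.I; Complex.I, 0], !![1, 0; 0, -1]]

/-- The component `α` of the spin operator at the site `x`,
`(1/2) ∑_{σ,τ} c†_{x,σ} (p^α)_{σ,τ} c_{x,τ}`. -/
def spin (x : Λ) (α : Fin 3) : Module.End ℂ (Fock Λ) :=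
  (1 / 2 : ℂ) • ∑ σ : Fin 2, ∑ τ : Fin 2, pauli α σ τ • (create x σ * annihilate x τ)

/-- The operator `S_x · S_y`. -/
def spinDot (x y : Λ) : Module.End ℂ (Fock Λ) :=
  ∑ α : Fin 3, spin x α * spin y α

/-- The states with exactly `N` electrons. -/
def sector (Λ : Type*) [Fintype Λ] [LinearOrder Λ] (N : ℕ) : Submodule ℂ (Fock Λ) :=
  LinearMap.ker (totalNumber Λ - (N : ℂ) • (1 : Module.End ℂ (Fock Λ)))

/-- `Φ` is a ground state of `H` at electron number `N`: a nonzero eigenvector of `H` in the space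
of the states with `N` electrons, whose eigenvalue is the lowest energy in that space. -/
def IsGroundState (H : Module.End ℂ (Fock Λ)) (N : ℕ) (Φ : Fock Λ) : Prop :=
  Φ ∈ sector Λ N ∧ Φ ≠ 0 ∧
    ∃ E : ℝ, H Φ = (E : ℂ) • Φ ∧
      ∀ Ψ ∈ sector Λ N, E * ‖Ψ‖ ^ 2 ≤ (inner ℂ Ψ (H Ψ)).re

/-- The hopping amplitudes `t` are bipartite with the sublattices `A` and `B`. -/
def IsBipartite (t : Λ → Λ → ℝ) (A B : Finset Λ) : Prop :=
  A ∪ B = Finset.univ ∧ Disjoint A B ∧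
    (∀ x ∈ A, ∀ y ∈ A, t x y = 0) ∧ (∀ x ∈ B, ∀ y ∈ B, t x y = 0)

/-- Any two sites are joined by a sequence of sites whose consecutive members have nonvanishing
hopping amplitude. -/
def IsConnected (t : Λ → Λ → ℝ) : Prop :=
  ∀ x y : Λ, Relation.ReflTransGen (fun u v => t u v ≠ 0) x y

end Hubbard

end

/-!
Ground states at half filling are described by matrices. A state is a matrix `X` of coefficients,
whose rows are the sets occupied by up electrons and whose columns are the sets occupied by down
electrons (`coeffMatrix`). A particle-hole transformation of the down electrons, with the sign `ε`
of the sublattice, turns `X` into `W` (`flip`). On a bipartite lattice at half filling the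
Hamiltonian becomes the attractive one, `W ↦ T W + W T - U ∑ x, n x * W * n x` (`liebMap`,
`flip_hamiltonian`), and the numbers of up and of transformed down electrons agree.

*Spin-reflection positivity.* If a Hermitian ground state has the Jordan decomposition
`W = P - N`, then `P + N` has no larger energy (`energy_abs_le`), so `P` and `N` are ground states
too. The kernel of a positive semidefinite ground state is invariant under the hopping `T` and the
occupations `n x` (`posSemidef_kernel_invariant`). On a connected lattice these act irreducibly on
the vectors with `M` particles (`irreducible`), so that the kernel is trivial there. Since
`P * N = 0`, one of `P` and `N` vanishes. Hence for each `M` the ground states with `M` up electrons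
are the multiples of a single `P` (`exists_posSemidef_spanning`).

*Spin flips.* The operator `S⁺_x S⁻_y` becomes `W ↦ ε x * ε y • A * W * Aᴴ` with `A = c†_x c_y`. So
its expectation value in `P`, multiplied by `ε x * ε y`, is `tr (P * A * P * Aᴴ) ≥ 0`, and it is
positive if `A` does not vanish on the vectors with `M` particles.

*Rotations.* The number of sites is even, so there is a sector with vanishing third spin component,
and it contains at most one ground state up to multiples. The raising and lowering operators join
every other sector to it without annihilating the ground states on the way (`lower_ne_zero`,
`raise_ne_zero`). As `S_x · S_y` commutes with them, its compression to the space of all ground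
states is a scalar `κ`, and every normalized ground state has the same correlation `κ`. The trace
over the ground states is rotation invariant, so it gives `S_x · S_y` the value `3 / 2` times that
of `S⁺_x S⁻_y` (`trace_mul_spinDot`), which has the sign of `ε x * ε y` (`pos_sign_mul_spinDot`).
-/

set_option linter.unusedSectionVars false

/-! ### Spinless fermions -/

namespace Hubbard

open Matrix

variable {Λ : Type*} [LinearOrder Λ]

/-- The sign `(-1) ^ #{z ∈ S | z < x}` which the spinless creation and annihilation operators at
`x` attach to the occupied set `S`. -/
def jwSign (x : Λ) (S : Finset Λ) : ℂ := (-1) ^ (S.filter (fun z => z < x)).card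

lemma jwSign_mul_self (x : Λ) (S : Finset Λ) : jwSign x S * jwSign x S = 1 := by
  rw [jwSign, ← mul_pow]; simp

lemma jwSign_ne_zero (x : Λ) (S : Finset Λ) : jwSign x S ≠ 0 :=
  left_ne_zero_of_mul_eq_one (jwSign_mul_self x S)

lemma star_jwSign (x : Λ) (S : Finset Λ) : star (jwSign x S) = jwSign x S := by
  simp [jwSign]

lemma jwSign_insert {x y : Λ} {S : Finset Λ} (hy : y ∉ S) :
    jwSign x (insert y S) = (if y < x then -1 else 1) * jwSign x S := by
  unfold jwSign
  rw [Finset.filter_insert]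
  split_ifs with h
  · rw [Finset.card_insert_of_notMem (by simp [hy]), pow_succ]; ring
  · simp

lemma jwSign_erase {x y : Λ} {S : Finset Λ} (hy : y ∈ S) :
    jwSign x (S.erase y) = (if y < x then -1 else 1) * jwSign x S := by
  have h := jwSign_insert (x := x) (Finset.notMem_erase y S)
  rw [Finset.insert_erase hy] at h
  rw [h]; split_ifs <;> simp

lemma jwSign_insert_self (x : Λ) (S : Finset Λ) : jwSign x (insert x S) = jwSign x S := by
  by_cases hx : x ∈ S
  · rw [Finset.insert_eq_of_mem hx]
  · simp [jwSign_insert hx]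

lemma jwSign_erase_self (x : Λ) (S : Finset Λ) : jwSign x (S.erase x) = jwSign x S := by
  by_cases hx : x ∈ S
  · simp [jwSign_erase hx]
  · rw [Finset.erase_eq_of_notMem hx]

/-- The matrix of the creation operator at `x` of spinless fermions on `Λ`, in the basis of the
occupied sets. -/
def cre (x : Λ) : Matrix (Finset Λ) (Finset Λ) ℂ :=
  Matrix.of fun T S => if x ∉ S ∧ T = insert x S then jwSign x S else 0

/-- The matrix of the occupation number of spinless fermions at `x`. -/
def occ (x : Λ) : Matrix (Finset Λ) (Finset Λ) ℂ :=
  Matrix.diagonal fun S => if x ∈ S then 1 else 0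

/-- The fermion parity `(-1) ^ N` of spinless fermions. -/
def parity (Λ : Type*) [LinearOrder Λ] : Matrix (Finset Λ) (Finset Λ) ℂ :=
  Matrix.diagonal fun S => (-1) ^ S.card

lemma cre_transpose (x : Λ) : (cre x)ᵀ = (cre x)ᴴ := by
  ext S T
  simp only [cre, transpose_apply, conjTranspose_apply, of_apply]
  split_ifs <;> simp [jwSign]

variable [Fintype Λ] {κ : Type*}

lemma cre_mul_apply (x : Λ) (A : Matrix (Finset Λ) κ ℂ) (T : Finset Λ) (R : κ) :
    (cre x * A) T R = if x ∈ T then jwSign x T * A (T.erase x) R else 0 := by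
  rw [Matrix.mul_apply]
  split_ifs with h
  · rw [Finset.sum_eq_single (T.erase x)]
    · simp [cre, Finset.insert_erase h, jwSign_erase_self]
    · intro S _ hS
      have : ¬ (x ∉ S ∧ T = insert x S) := by
        rintro ⟨h1, rfl⟩; exact hS (Finset.erase_insert h1).symm
      simp [cre, this]
    · simp
  · refine Finset.sum_eq_zero fun S _ => ?_
    have : ¬ (x ∉ S ∧ T = insert x S) := by
      rintro ⟨h1, rfl⟩; exact h (Finset.mem_insert_self _ _)
    simp [cre, this]

lemma ann_mul_apply (x : Λ) (A : Matrix (Finset Λ) κ ℂ) (S : Finset Λ) (R : κ) :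
    ((cre x)ᴴ * A) S R = if x ∈ S then 0 else jwSign x S * A (insert x S) R := by
  rw [Matrix.mul_apply]
  split_ifs with h
  · refine Finset.sum_eq_zero fun S _ => ?_
    simp [cre, h]
  · rw [Finset.sum_eq_single (insert x S)]
    · simp [cre, h, jwSign]
    · intro T _ hT
      simp [cre, hT]
    · simp

lemma cre_mul_ann_self (x : Λ) : cre x * (cre x)ᴴ = occ x := by
  ext S T
  rw [← mul_one (cre x)ᴴ, cre_mul_apply, ann_mul_apply]
  by_cases h : x ∈ S <;>
    simp [h, occ, Matrix.diagonal_apply, Matrix.one_apply, Finset.insert_erase,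
      jwSign_erase_self, jwSign_mul_self]

lemma cre_mul_cre (x y : Λ) : cre x * cre y + cre y * cre x = 0 := by
  ext S T
  have h : cre x * cre y + cre y * cre x = cre x * (cre y * 1) + cre y * (cre x * 1) := by
    simp only [mul_one]
  rw [h, Matrix.add_apply, cre_mul_apply, cre_mul_apply, cre_mul_apply, cre_mul_apply]
  rcases eq_or_ne x y with rfl | hxy
  · simp
  by_cases hx : x ∈ S <;> by_cases hy : y ∈ S <;> simp [hx, hy, hxy, hxy.symm]
  rw [jwSign_erase hx, jwSign_erase hy, Finset.erase_right_comm]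
  rcases lt_or_gt_of_ne hxy with h | h <;> simp [h, h.not_gt] <;> ring

/-- The canonical anticommutation relations of spinless fermions. -/
lemma ann_mul_cre (x y : Λ) :
    (cre x)ᴴ * cre y + cre y * (cre x)ᴴ = if x = y then 1 else 0 := by
  ext S T
  have h : (cre x)ᴴ * cre y + cre y * (cre x)ᴴ
      = (cre x)ᴴ * (cre y * 1) + cre y * ((cre x)ᴴ * 1) := by
    simp only [mul_one]
  rw [h, Matrix.add_apply, ann_mul_apply, cre_mul_apply, cre_mul_apply, ann_mul_apply]
  rcases eq_or_ne x y with rfl | hxy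
  · by_cases hx : x ∈ S <;>
      simp only [hx, if_true, if_false, Finset.mem_insert_self, Finset.notMem_erase,
        ← mul_assoc, jwSign_erase_self, jwSign_insert_self, jwSign_mul_self, add_zero, zero_add,
        one_mul]
    · rw [Finset.insert_erase hx]
    · rw [Finset.erase_insert hx]
  by_cases hx : x ∈ S <;> by_cases hy : y ∈ S <;> simp [hx, hy, hxy, hxy.symm]
  rw [jwSign_erase hy, jwSign_insert hx, Finset.erase_insert_of_ne hxy]
  rcases lt_or_gt_of_ne hxy with h | h <;> simp [h, h.not_gt] <;> ring

lemma parity_mul_self : parity Λ * parity Λ = 1 := by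
  simp [parity, Matrix.diagonal_mul_diagonal, ← mul_pow]

lemma parity_mul_parity_mul (A : Matrix (Finset Λ) κ ℂ) : parity Λ * (parity Λ * A) = A := by
  rw [← Matrix.mul_assoc, parity_mul_self, Matrix.one_mul]

omit [Fintype Λ] in
lemma parity_conjTranspose : (parity Λ)ᴴ = parity Λ := by
  rw [parity, diagonal_conjTranspose]
  congr 1; ext S; simp

lemma parity_mul_cre (x : Λ) : parity Λ * cre x = - (cre x * parity Λ) := by
  ext S T
  rw [Matrix.neg_apply, parity, Matrix.diagonal_mul, Matrix.mul_diagonal]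
  simp only [cre, of_apply]
  split_ifs with h
  · rw [h.2, Finset.card_insert_of_notMem h.1]; ring
  · simp

lemma parity_mul_ann (x : Λ) : parity Λ * (cre x)ᴴ = - ((cre x)ᴴ * parity Λ) := by
  have := congrArg conjTranspose (parity_mul_cre x)
  simp only [conjTranspose_mul, conjTranspose_neg, parity_conjTranspose] at this
  rw [this, neg_neg]

/-- The particle-hole transformation of spinless fermions for a choice of signs `ε`: the signed
permutation matrix which exchanges each occupied set with its complement. -/
def particleHole (ε : Λ → ℂ) : Matrix (Finset Λ) (Finset Λ) ℂ :=
  Matrix.of fun S T => if S = Tᶜ then ∏ z ∈ T, ε z * jwSign z Finset.univ else 0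

lemma jwSign_compl (x : Λ) (S : Finset Λ) :
    jwSign x Sᶜ = jwSign x Finset.univ * jwSign x S := by
  have : jwSign x Finset.univ = jwSign x Sᶜ * jwSign x S := by
    unfold jwSign
    rw [← pow_add, ← Finset.card_union_of_disjoint
      (Finset.disjoint_filter_filter disjoint_compl_left), ← Finset.filter_union,
      Finset.union_comm, Finset.union_compl]
  rw [this, mul_assoc, jwSign_mul_self, mul_one]

lemma particleHole_conjTranspose_mul {ε : Λ → ℂ} (hε : ∀ x, ε x = 1 ∨ ε x = -1) :
    (particleHole ε)ᴴ * particleHole ε = 1 := by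
  ext S T
  rw [Matrix.mul_apply, Finset.sum_eq_single Tᶜ]
  · rcases eq_or_ne S T with rfl | h
    · have h1 : ∀ z, star (ε z * jwSign z Finset.univ) * (ε z * jwSign z Finset.univ) = 1 := by
        intro z
        rw [star_mul', star_jwSign, mul_mul_mul_comm, jwSign_mul_self]
        rcases hε z with h | h <;> simp [h]
      simp only [particleHole, conjTranspose_apply, of_apply, if_true, Matrix.one_apply_eq]
      rw [star_prod, ← Finset.prod_mul_distrib]
      exact Finset.prod_eq_one fun z _ => h1 z
    · have : Tᶜ ≠ Sᶜ := fun h' => h (compl_injective h').symm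
      simp [particleHole, this, h]
  · intro R _ hR
    simp [particleHole, hR]
  · simp

lemma particleHole_mul_conjTranspose {ε : Λ → ℂ} (hε : ∀ x, ε x = 1 ∨ ε x = -1) :
    particleHole ε * (particleHole ε)ᴴ = 1 :=
  mul_eq_one_comm.mp (particleHole_conjTranspose_mul hε)

/-- The particle-hole transformation exchanges creation and annihilation up to the sign `ε x`. -/
lemma cre_mul_particleHole (ε : Λ → ℂ) (x : Λ) :
    cre x * particleHole ε = ε x • (particleHole ε * (cre x)ᴴ) := by
  ext S T
  rw [cre_mul_apply, Matrix.smul_apply, Matrix.mul_apply]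
  by_cases hT : x ∈ T
  · rw [Finset.sum_eq_single (T.erase x)]
    · by_cases hS : x ∈ S
      · by_cases hST : S = (T.erase x)ᶜ
        · have h1 : S.erase x = Tᶜ := by
            rw [hST]; ext z; by_cases hz : z = x <;> simp [hz, hT]
          have h2 : jwSign x S = jwSign x Finset.univ * jwSign x (T.erase x) := by
            rw [hST, jwSign_compl]
          simp only [hS, if_true, particleHole, of_apply, h1, conjTranspose_apply, cre,
            Finset.notMem_erase, not_false_eq_true, Finset.insert_erase hT, true_and,
            star_jwSign, smul_eq_mul]
          rw [if_pos hST, ← Finset.mul_prod_erase T _ hT, h2, jwSign_erase_self]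
          have := jwSign_mul_self x Finset.univ
          linear_combination (jwSign x T * ε x * ∏ z ∈ T.erase x, ε z * jwSign z Finset.univ) * this
        · have h1 : S.erase x ≠ Tᶜ := by
            intro h; apply hST; ext z
            by_cases hz : z = x
            · simp [hz, hS]
            · have := Finset.ext_iff.1 h z; simpa [hz] using this
          simp only [particleHole, of_apply, if_neg h1, if_neg hST]; simp
      · have hST : S ≠ (T.erase x)ᶜ := by rintro rfl; simp at hS
        simp only [particleHole, of_apply, if_neg hS, if_neg hST]; simp
    · intro R _ hR
      have : ¬ (x ∉ R ∧ T = insert x R) := by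
        rintro ⟨h1, rfl⟩; exact hR (Finset.erase_insert h1).symm
      simp [cre, this]
    · simp
  · have h1 : S.erase x ≠ Tᶜ := by
      intro h
      have := Finset.ext_iff.1 h x
      simp [hT] at this
    rw [Finset.sum_eq_zero]
    · simp [particleHole, h1]
    · intro R _
      have : ¬ (x ∉ R ∧ T = insert x R) := by
        rintro ⟨_, rfl⟩; exact hT (Finset.mem_insert_self _ _)
      simp [cre, this]

lemma ann_mul_particleHole {ε : Λ → ℂ} (hε : ∀ x, ε x = 1 ∨ ε x = -1) (x : Λ) :
    (cre x)ᴴ * particleHole ε = ε x • (particleHole ε * cre x) := by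
  have h := congrArg conjTranspose (cre_mul_particleHole ε x)
  have h2 := congrArg (fun A => particleHole ε * A * particleHole ε) h
  have hs : star (ε x) = ε x := by rcases hε x with h | h <;> simp [h]
  simp only [conjTranspose_mul, conjTranspose_smul, conjTranspose_conjTranspose, hs] at h2
  rw [← mul_assoc, particleHole_mul_conjTranspose hε, one_mul, Matrix.mul_smul, Matrix.smul_mul,
    mul_assoc, mul_assoc, particleHole_conjTranspose_mul hε, mul_one] at h2
  exact h2

end Hubbard

/-! ### The Fock space as a space of matrices -/

namespace Hubbard

open Matrix

variable {Λ : Type*} [Fintype Λ] [LinearOrder Λ]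

/-- The matrix of coefficients of a state: the entry at `(S, T)` is the coefficient of the basis
vector with up electrons at `S` and down electrons at `T`. -/
noncomputable def coeffMatrix : Fock Λ ≃ₗ[ℂ] Matrix (Finset Λ) (Finset Λ) ℂ where
  toFun Φ := Matrix.of fun S T => Φ ![S, T]
  invFun X := WithLp.toLp 2 fun S => X (S 0) (S 1)
  map_add' Φ Ψ := by ext; simp
  map_smul' c Φ := by ext; simp
  left_inv Φ := by
    ext S
    have : ![S 0, S 1] = S := by ext i; fin_cases i <;> rfl
    simp [this]
  right_inv X := by ext; simp

lemma coeffMatrix_apply (Φ : Fock Λ) (S T : Finset Λ) : coeffMatrix Φ S T = Φ ![S, T] := rfl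

lemma inner_eq_trace (Φ Ψ : Fock Λ) :
    inner ℂ Φ Ψ = ((coeffMatrix Φ)ᴴ * coeffMatrix Ψ).trace := by
  rw [PiLp.inner_apply, Matrix.trace, ← (finTwoArrowEquiv (Finset Λ)).symm.sum_comp,
    Fintype.sum_prod_type, Finset.sum_comm]
  refine Finset.sum_congr rfl fun T _ => ?_
  rw [Matrix.diag_apply, Matrix.mul_apply]
  refine Finset.sum_congr rfl fun S _ => ?_
  simp [coeffMatrix_apply, finTwoArrowEquiv, mul_comm]

lemma numBefore_zero (S : Config Λ) (x : Λ) :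
    (-1 : ℂ) ^ numBefore S 0 x = jwSign x (S 0) := by
  simp [numBefore, jwSign]

lemma numBefore_one (S : Config Λ) (x : Λ) :
    (-1 : ℂ) ^ numBefore S 1 x = (-1) ^ (S 0).card * jwSign x (S 1) := by
  have : (Finset.univ.filter fun τ : Fin 2 => τ < 1) = {0} := by decide
  rw [numBefore, this, Finset.sum_singleton, pow_add, jwSign]

lemma create_apply (x : Λ) (σ : Fin 2) (Φ : Fock Λ) (S : Config Λ) :
    create x σ Φ S = if x ∈ S σ then
      (-1 : ℂ) ^ numBefore (Function.update S σ ((S σ).erase x)) σ x *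
        Φ (Function.update S σ ((S σ).erase x)) else 0 := by
  rw [create, Matrix.toLpLin_apply]
  simp only [Matrix.mulVec, dotProduct, of_apply]
  split_ifs with h
  · rw [Finset.sum_eq_single (Function.update S σ ((S σ).erase x))]
    · simp [Finset.insert_erase h]
    · intro R _ hR
      rw [if_neg, zero_mul]
      rintro ⟨h1, rfl⟩
      apply hR
      simp [Finset.erase_insert h1]
    · simp
  · refine Finset.sum_eq_zero fun R _ => ?_
    rw [if_neg, zero_mul]
    rintro ⟨h1, rfl⟩
    simp at h

lemma mul_cre_transpose_apply (X : Matrix (Finset Λ) (Finset Λ) ℂ) (x : Λ) (S T : Finset Λ) :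
    (X * (cre x)ᵀ) S T = if x ∈ T then jwSign x T * X S (T.erase x) else 0 := by
  rw [← Matrix.transpose_apply (X * (cre x)ᵀ), transpose_mul, transpose_transpose, cre_mul_apply]
  rfl

lemma coeffMatrix_create_zero (x : Λ) (Φ : Fock Λ) :
    coeffMatrix (create x 0 Φ) = cre x * coeffMatrix Φ := by
  ext S T
  rw [coeffMatrix_apply, create_apply, cre_mul_apply, numBefore_zero]
  have : Function.update ![S, T] 0 (S.erase x) = ![S.erase x, T] := by
    ext i; fin_cases i <;> rfl
  simp [this, coeffMatrix_apply, jwSign_erase_self]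

/-- The parity factor is the sign for passing all the up electrons. -/
lemma coeffMatrix_create_one (x : Λ) (Φ : Fock Λ) :
    coeffMatrix (create x 1 Φ) = parity Λ * coeffMatrix Φ * (cre x)ᵀ := by
  ext S T
  rw [coeffMatrix_apply, create_apply, mul_cre_transpose_apply, numBefore_one]
  have : Function.update ![S, T] 1 (T.erase x) = ![S, T.erase x] := by
    ext i; fin_cases i <;> rfl
  simp only [this, coeffMatrix_apply, jwSign_erase_self, parity, diagonal_mul, Matrix.cons_val_one,
    Matrix.cons_val_zero, Matrix.cons_val_fin_one]
  split_ifs <;> ring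

lemma coeffMatrix_annihilate_zero (x : Λ) (Φ : Fock Λ) :
    coeffMatrix (annihilate x 0 Φ) = (cre x)ᴴ * coeffMatrix Φ := by
  rw [← LinearEquiv.eq_symm_apply]
  refine ext_inner_right ℂ fun Ψ => ?_
  rw [annihilate, LinearMap.adjoint_inner_left, inner_eq_trace, inner_eq_trace,
    coeffMatrix_create_zero, LinearEquiv.apply_symm_apply]
  simp [conjTranspose_mul, mul_assoc]

lemma coeffMatrix_annihilate_one (x : Λ) (Φ : Fock Λ) :
    coeffMatrix (annihilate x 1 Φ) = parity Λ * coeffMatrix Φ * cre x := by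
  rw [← LinearEquiv.eq_symm_apply]
  refine ext_inner_right ℂ fun Ψ => ?_
  rw [annihilate, LinearMap.adjoint_inner_left, inner_eq_trace, inner_eq_trace,
    coeffMatrix_create_one, LinearEquiv.apply_symm_apply, cre_transpose]
  simp only [conjTranspose_mul, parity_conjTranspose]
  rw [← mul_assoc, trace_mul_comm]
  simp only [mul_assoc]

lemma anticomm_create (x y : Λ) (σ τ : Fin 2) :
    create x σ * create y τ = - (create y τ * create x σ) := by
  have h := cre_mul_cre x y
  rw [add_eq_zero_iff_eq_neg] at h
  have hT : (cre y)ᵀ * (cre x)ᵀ = - ((cre x)ᵀ * (cre y)ᵀ) := by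
    rw [← transpose_mul, h, transpose_neg, transpose_mul]
  refine LinearMap.ext fun Φ => coeffMatrix.injective ?_
  rw [LinearMap.neg_apply, map_neg, Module.End.mul_apply, Module.End.mul_apply]
  fin_cases σ <;> fin_cases τ <;>
    simp only [Fin.zero_eta, Fin.mk_one, coeffMatrix_create_zero, coeffMatrix_create_one]
  · rw [← mul_assoc, h, neg_mul, mul_assoc]
  · simp only [← mul_assoc, parity_mul_cre]; simp
  · simp only [← mul_assoc, parity_mul_cre]; simp
  · simp only [mul_assoc, parity_mul_parity_mul, hT]; simp

lemma anticomm_annihilate_create (x y : Λ) (σ τ : Fin 2) :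
    annihilate x σ * create y τ =
      (if x = y ∧ σ = τ then 1 else 0) - create y τ * annihilate x σ := by
  have h := ann_mul_cre x y
  rw [← eq_sub_iff_add_eq] at h
  have hT : (cre y)ᵀ * cre x = (if x = y then 1 else 0) - cre x * (cre y)ᵀ := by
    have h' := ann_mul_cre y x
    rw [← eq_sub_iff_add_eq] at h'
    simp only [cre_transpose, h', eq_comm]
  refine LinearMap.ext fun Φ => coeffMatrix.injective ?_
  rw [LinearMap.sub_apply, map_sub, Module.End.mul_apply, Module.End.mul_apply]
  have h1 : ∀ p : Prop, [Decidable p] →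
      coeffMatrix ((if p then (1 : Module.End ℂ (Fock Λ)) else 0) Φ) = if p then coeffMatrix Φ else 0 := by
    intro p _; split_ifs <;> simp
  rw [h1]
  fin_cases σ <;> fin_cases τ <;>
    simp only [Fin.zero_eta, Fin.mk_one, coeffMatrix_create_zero, coeffMatrix_create_one,
      coeffMatrix_annihilate_zero, coeffMatrix_annihilate_one]
  · rw [← mul_assoc, h, sub_mul, mul_assoc]
    by_cases hxy : x = y <;> simp [hxy]
  · simp only [← mul_assoc, parity_mul_ann]; simp
  · simp only [← mul_assoc, parity_mul_cre]; simp
  · simp only [mul_assoc, parity_mul_parity_mul, hT, mul_sub]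
    by_cases hxy : x = y <;> simp [hxy]

lemma adjoint_create (x : Λ) (σ : Fin 2) : LinearMap.adjoint (create x σ) = annihilate x σ := rfl

lemma adjoint_annihilate (x : Λ) (σ : Fin 2) : LinearMap.adjoint (annihilate x σ) = create x σ :=
  LinearMap.adjoint_adjoint _

lemma anticomm_annihilate (x y : Λ) (σ τ : Fin 2) :
    annihilate x σ * annihilate y τ = - (annihilate y τ * annihilate x σ) := by
  have := congrArg LinearMap.adjoint (anticomm_create y x τ σ)
  simpa [Module.End.mul_eq_comp, LinearMap.adjoint_comp, adjoint_create] using this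

/-- The one-particle operator `c†_{x,σ} c_{y,τ}`. -/
noncomputable def transfer (x : Λ) (σ : Fin 2) (y : Λ) (τ : Fin 2) : Module.End ℂ (Fock Λ) :=
  create x σ * annihilate y τ

lemma adjoint_transfer (x : Λ) (σ : Fin 2) (y : Λ) (τ : Fin 2) :
    LinearMap.adjoint (transfer x σ y τ) = transfer y τ x σ := by
  simp [transfer, Module.End.mul_eq_comp, LinearMap.adjoint_comp, adjoint_create,
    adjoint_annihilate]

/-- The commutation relations of the general linear Lie algebra, which the one-particle operators
inherit from the canonical anticommutation relations. -/
lemma transfer_commutator (x y z w : Λ) (σ τ ρ υ : Fin 2) :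
    transfer x σ y τ * transfer z ρ w υ - transfer z ρ w υ * transfer x σ y τ =
      (if y = z ∧ τ = ρ then transfer x σ w υ else 0) -
        (if x = w ∧ σ = υ then transfer z ρ y τ else 0) := by
  have h1 : ∀ p : Prop, [Decidable p] → ∀ a b : Module.End ℂ (Fock Λ),
      a * (if p then 1 else 0) * b = if p then a * b else 0 := by
    intro p _ a b; split_ifs <;> simp
  have e1 : transfer x σ y τ * transfer z ρ w υ =
      create x σ * (annihilate y τ * create z ρ) * annihilate w υ := by
    simp only [transfer, mul_assoc]
  have e2 : transfer z ρ w υ * transfer x σ y τ =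
      create z ρ * (annihilate w υ * create x σ) * annihilate y τ := by
    simp only [transfer, mul_assoc]
  have e3 : create x σ * (create z ρ * annihilate y τ) * annihilate w υ =
      create z ρ * (create x σ * annihilate w υ) * annihilate y τ := by
    rw [← mul_assoc, anticomm_create x z, mul_assoc, anticomm_annihilate y w]
    simp [mul_assoc]
  rw [e1, e2, anticomm_annihilate_create, anticomm_annihilate_create, mul_sub, mul_sub, sub_mul,
    sub_mul, h1, h1, e3]
  simp only [transfer, eq_comm (a := w), eq_comm (a := υ)]
  abel

end Hubbard

/-! ### Global spin rotations -/

namespace Hubbard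

variable {Λ : Type*} [Fintype Λ] [LinearOrder Λ]

/-- The generators `∑_x c†_{x,σ} c_{x,τ}` of the global rotations of the spin space. The spin
raising operator is `total 0 1`, the lowering operator is `total 1 0`, and the numbers of up and
down electrons are `total 0 0` and `total 1 1`. -/
noncomputable def total (Λ : Type*) [Fintype Λ] [LinearOrder Λ] (σ τ : Fin 2) :
    Module.End ℂ (Fock Λ) :=
  ∑ x : Λ, transfer x σ x τ

lemma adjoint_total (σ τ : Fin 2) : LinearMap.adjoint (total Λ σ τ) = total Λ τ σ := by
  simp [total, map_sum, adjoint_transfer]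

lemma totalNumber_eq : totalNumber Λ = total Λ 0 0 + total Λ 1 1 := by
  simp only [totalNumber, total, Finset.sum_add_distrib]
  rfl

lemma total_commutator_transfer (y z : Λ) (σ τ ρ υ : Fin 2) :
    total Λ σ τ * transfer y ρ z υ - transfer y ρ z υ * total Λ σ τ =
      (if τ = ρ then transfer y σ z υ else 0) - (if σ = υ then transfer y ρ z τ else 0) := by
  rw [total, Finset.sum_mul, Finset.mul_sum, ← Finset.sum_sub_distrib]
  simp only [transfer_commutator, Finset.sum_sub_distrib, ite_and]
  simp

lemma total_commutator_total (σ τ ρ υ : Fin 2) :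
    total Λ σ τ * total Λ ρ υ - total Λ ρ υ * total Λ σ τ =
      (if τ = ρ then total Λ σ υ else 0) - (if σ = υ then total Λ ρ τ else 0) := by
  have : total Λ ρ υ = ∑ y, transfer y ρ y υ := rfl
  rw [this, Finset.sum_mul, Finset.mul_sum, ← Finset.sum_sub_distrib]
  simp only [total_commutator_transfer, Finset.sum_sub_distrib]
  split_ifs <;> simp [total]

/-- The commutator with a fixed element is a derivation. -/
lemma commutator_mul {R : Type*} [Ring R] (a b c : R) :
    a * (b * c) - b * c * a = (a * b - b * a) * c + b * (a * c - c * a) := by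
  noncomm_ring

lemma commute_total_hopping (t : Λ → Λ → ℝ) (σ τ : Fin 2) :
    Commute (total Λ σ τ) (hopping t) := by
  have h : ∀ x y : Λ, Commute (total Λ σ τ) (∑ ρ : Fin 2, transfer x ρ y ρ) := by
    intro x y
    rw [commute_iff_eq, ← sub_eq_zero, Finset.sum_mul, Finset.mul_sum, ← Finset.sum_sub_distrib]
    simp only [total_commutator_transfer, Finset.sum_sub_distrib]
    simp
  have e : hopping t = ∑ x : Λ, ∑ y : Λ, (t x y : ℂ) • ∑ ρ : Fin 2, transfer x ρ y ρ := by
    simp only [hopping, transfer, Finset.smul_sum]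
  rw [e]
  exact Commute.sum_right _ _ _ fun x _ => Commute.sum_right _ _ _ fun y _ => (h x y).smul_right _

lemma annihilate_mul_annihilate_self (x : Λ) (σ : Fin 2) :
    annihilate x σ * annihilate x σ = 0 := by
  have h := anticomm_annihilate x x σ σ
  rwa [eq_neg_iff_add_eq_zero, ← two_smul ℂ, smul_eq_zero_iff_right two_ne_zero] at h

lemma create_mul_create_self (x : Λ) (σ : Fin 2) : create x σ * create x σ = 0 := by
  have h := anticomm_create x x σ σ
  rwa [eq_neg_iff_add_eq_zero, ← two_smul ℂ, smul_eq_zero_iff_right two_ne_zero] at h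

lemma transfer_mul_number (x : Λ) (σ τ : Fin 2) :
    transfer x σ x τ * transfer x τ x τ = transfer x σ x τ := by
  have : transfer x σ x τ * transfer x τ x τ =
      create x σ * (annihilate x τ * create x τ) * annihilate x τ := by
    simp only [transfer, mul_assoc]
  rw [this, anticomm_annihilate_create, if_pos ⟨rfl, rfl⟩, mul_sub, sub_mul, mul_one]
  simp [mul_assoc, annihilate_mul_annihilate_self, transfer]

lemma number_mul_transfer (x : Λ) (σ τ : Fin 2) :
    transfer x σ x σ * transfer x σ x τ = transfer x σ x τ := by
  have : transfer x σ x σ * transfer x σ x τ =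
      create x σ * (annihilate x σ * create x σ) * annihilate x τ := by
    simp only [transfer, mul_assoc]
  rw [this, anticomm_annihilate_create, if_pos ⟨rfl, rfl⟩, mul_sub, sub_mul, mul_one, ← mul_assoc,
    create_mul_create_self, zero_mul, zero_mul, sub_zero, transfer]

lemma commute_total_interaction (U : Λ → ℝ) (σ τ : Fin 2) :
    Commute (total Λ σ τ) (interaction U) := by
  have h : ∀ x : Λ, Commute (total Λ σ τ) (number x 0 * number x 1) := by
    intro x
    change Commute (total Λ σ τ) (transfer x 0 x 0 * transfer x 1 x 1)
    rw [commute_iff_eq, ← sub_eq_zero, commutator_mul, total_commutator_transfer,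
      total_commutator_transfer]
    fin_cases σ <;> fin_cases τ
    · simp
    · simp [transfer_mul_number, number_mul_transfer]
    · -- the down-flip moves the number operators to the side where they act trivially
      have h1 := transfer_commutator x x x x 1 0 1 1
      have h2 := transfer_commutator x x x x 1 0 0 0
      simp [transfer_mul_number, number_mul_transfer] at h1 h2
      simp [h1, h2]
    · simp
  exact Commute.sum_right _ _ _ fun x _ => (h x).smul_right _

lemma commute_total_hamiltonian (t : Λ → Λ → ℝ) (U : Λ → ℝ) (σ τ : Fin 2) :
    Commute (total Λ σ τ) (hamiltonian t U) :=
  (commute_total_hopping t σ τ).add_right (commute_total_interaction U σ τ)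

lemma adjoint_hamiltonian {t : Λ → Λ → ℝ} (ht : ∀ x y, t x y = t y x) (U : Λ → ℝ) :
    LinearMap.adjoint (hamiltonian t U) = hamiltonian t U := by
  have e : hopping t = ∑ x : Λ, ∑ y : Λ, ∑ σ : Fin 2, (t x y : ℂ) • transfer x σ y σ := rfl
  have e' : interaction U = ∑ x : Λ, (U x : ℂ) • (transfer x 0 x 0 * transfer x 1 x 1) := rfl
  have h1 : LinearMap.adjoint (hopping t) = hopping t := by
    rw [e]
    simp only [map_sum, map_smulₛₗ, adjoint_transfer, Complex.conj_ofReal]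
    rw [Finset.sum_comm]
    simp only [ht]
  have h2 : LinearMap.adjoint (interaction U) = interaction U := by
    rw [e']
    simp only [map_sum, map_smulₛₗ, Module.End.mul_eq_comp, LinearMap.adjoint_comp,
      adjoint_transfer, Complex.conj_ofReal]
    refine Finset.sum_congr rfl fun x _ => ?_
    have := transfer_commutator x x x x 0 0 1 1
    simp only [Module.End.mul_eq_comp] at this
    rw [sub_eq_iff_eq_add.1 this]
    simp
  rw [hamiltonian, map_add, h1, h2]

/-- Twice the third component of the spin at `x`. -/
noncomputable def polarization (x : Λ) : Module.End ℂ (Fock Λ) :=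
  transfer x 0 x 0 - transfer x 1 x 1

lemma spinDot_eq (x y : Λ) :
    spinDot x y = (1 / 4 : ℂ) • (polarization x * polarization y) +
      (1 / 2 : ℂ) • (transfer x 0 x 1 * transfer y 1 y 0 +
        transfer x 1 x 0 * transfer y 0 y 1) := by
  have h0 : ∀ z : Λ, spin z 0 = (1 / 2 : ℂ) • (transfer z 0 z 1 + transfer z 1 z 0) := by
    intro z; simp [spin, pauli, Fin.sum_univ_two, transfer]
  have h1 : ∀ z : Λ, spin z 1 = (1 / 2 : ℂ) • (-Complex.I • transfer z 0 z 1 +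
      Complex.I • transfer z 1 z 0) := by
    intro z; simp [spin, pauli, Fin.sum_univ_two, transfer]
  have h2 : ∀ z : Λ, spin z 2 = (1 / 2 : ℂ) • polarization z := by
    intro z; simp [spin, pauli, Fin.sum_univ_two, transfer, polarization, sub_eq_add_neg]
  rw [spinDot, Fin.sum_univ_three, h0, h0, h1, h1, h2, h2]
  simp only [smul_mul_smul_comm, mul_add, add_mul]
  simp only [smul_add, smul_smul]
  have : Complex.I * Complex.I = -1 := Complex.I_mul_I
  ring_nf
  simp only [Complex.I_sq]
  module

lemma commute_total_spinDot (x y : Λ) (σ τ : Fin 2) : Commute (total Λ σ τ) (spinDot x y) := by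
  rw [spinDot_eq, commute_iff_eq, ← sub_eq_zero]
  simp only [mul_add, add_mul, mul_smul_comm, smul_mul_assoc]
  have h1 := commutator_mul (total Λ σ τ) (polarization x) (polarization y)
  have h2 := commutator_mul (total Λ σ τ) (transfer x 0 x 1) (transfer y 1 y 0)
  have h3 := commutator_mul (total Λ σ τ) (transfer x 1 x 0) (transfer y 0 y 1)
  have hp : ∀ z : Λ, total Λ σ τ * polarization z - polarization z * total Λ σ τ =
      ((if τ = 0 then transfer z σ z 0 else 0) - (if σ = 0 then transfer z 0 z τ else 0)) -
      ((if τ = 1 then transfer z σ z 1 else 0) - (if σ = 1 then transfer z 1 z τ else 0)) := by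
    intro z
    rw [← total_commutator_transfer, ← total_commutator_transfer, polarization]
    noncomm_ring
  rw [hp, hp] at h1
  rw [total_commutator_transfer, total_commutator_transfer] at h2 h3
  rw [sub_eq_iff_eq_add] at h1 h2 h3
  rw [h1, h2, h3]
  fin_cases σ <;> fin_cases τ <;> simp [polarization, mul_sub, sub_mul, mul_add, add_mul, mul_assoc] <;> module

end Hubbard

/-! ### Spin-reflection positivity -/

namespace Hubbard

open Matrix

section Lieb

variable {n ι : Type*} [Fintype n] [DecidableEq n] [Fintype ι]

open scoped MatrixOrder in
/-- The Jordan decomposition of a Hermitian matrix. -/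
lemma exists_posSemidef_sub {W : Matrix n n ℂ} (hW : W.IsHermitian) :
    ∃ P N : Matrix n n ℂ, P.PosSemidef ∧ N.PosSemidef ∧ P * N = 0 ∧ W = P - N :=
  ⟨W⁺, W⁻, (CFC.posPart_nonneg W).posSemidef, (CFC.negPart_nonneg W).posSemidef,
    CFC.posPart_mul_negPart W, (CFC.posPart_sub_negPart W hW).symm⟩

open scoped MatrixOrder in
lemma exists_conjTranspose_mul_self {P : Matrix n n ℂ} (hP : P.PosSemidef) :
    ∃ B : Matrix n n ℂ, P = Bᴴ * B := by
  obtain ⟨B, hB⟩ := CStarAlgebra.nonneg_iff_eq_star_mul_self.mp hP.nonneg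
  exact ⟨B, hB⟩

lemma trace_mul_nonneg {P Q : Matrix n n ℂ} (hP : P.PosSemidef) (hQ : Q.PosSemidef) :
    0 ≤ (P * Q).trace := by
  obtain ⟨B, rfl⟩ := exists_conjTranspose_mul_self hP
  rw [mul_assoc, trace_mul_comm]
  exact (hQ.mul_mul_conjTranspose_same B).trace_nonneg

lemma trace_sandwich_nonneg {P : Matrix n n ℂ} (hP : P.PosSemidef) (A : Matrix n n ℂ) :
    0 ≤ (P * (A * P * Aᴴ)).trace :=
  trace_mul_nonneg hP (hP.mul_mul_conjTranspose_same A)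

lemma sandwich_eq_zero {P : Matrix n n ℂ} (hP : P.PosSemidef) {A : Matrix n n ℂ}
    (h : (P * (A * P * Aᴴ)).trace = 0) : P * A * P = 0 := by
  obtain ⟨B, rfl⟩ := exists_conjTranspose_mul_self hP
  have h1 : ((B * A * Bᴴ) * (B * A * Bᴴ)ᴴ).trace = 0 := by
    rw [← h, mul_assoc Bᴴ B, trace_mul_comm Bᴴ]
    simp only [conjTranspose_mul, conjTranspose_conjTranspose, mul_assoc]
  have h2 := trace_mul_conjTranspose_self_eq_zero_iff.mp h1
  calc Bᴴ * B * A * (Bᴴ * B) = Bᴴ * (B * A * Bᴴ) * B := by simp only [mul_assoc]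
    _ = 0 := by rw [h2]; simp

/-- The action of the attractive Hubbard Hamiltonian on coefficient matrices: `T` acts on both
spins, and the interaction multiplies by the occupations `m i` of both spins. -/
def liebMap (T : Matrix n n ℂ) (m : ι → Matrix n n ℂ) (U : ℝ) (W : Matrix n n ℂ) :
    Matrix n n ℂ :=
  T * W + W * T - (U : ℂ) • ∑ i, m i * W * m i

variable {T : Matrix n n ℂ} {m : ι → Matrix n n ℂ} {U : ℝ}

lemma liebMap_add (V W : Matrix n n ℂ) :
    liebMap T m U (V + W) = liebMap T m U V + liebMap T m U W := by
  simp only [liebMap, mul_add, add_mul, Finset.sum_add_distrib, smul_add]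
  abel

lemma liebMap_smul (c : ℂ) (W : Matrix n n ℂ) :
    liebMap T m U (c • W) = c • liebMap T m U W := by
  simp only [liebMap, mul_smul_comm, smul_mul_assoc, ← Finset.smul_sum, smul_sub, smul_add]
  rw [smul_comm]

lemma liebMap_conjTranspose (hT : T.IsHermitian) (hm : ∀ i, (m i).IsHermitian)
    (W : Matrix n n ℂ) : liebMap T m U Wᴴ = (liebMap T m U W)ᴴ := by
  simp only [liebMap, conjTranspose_sub, conjTranspose_add, conjTranspose_mul, conjTranspose_smul,
    conjTranspose_sum, hT.eq, (hm _).eq, mul_assoc]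
  simp [add_comm]

/-- Replacing a Hermitian coefficient matrix `P - N` by its absolute value `P + N` does not raise
the energy, because the cross terms `tr (P m N m)` of the attractive interaction are nonnegative. -/
lemma energy_abs_le (hm : ∀ i, (m i).IsHermitian) (hU : 0 ≤ U)
    {P N : Matrix n n ℂ} (hP : P.PosSemidef) (hN : N.PosSemidef) (hPN : P * N = 0) :
    (((P + N)ᴴ * liebMap T m U (P + N)).trace).re ≤
      (((P - N)ᴴ * liebMap T m U (P - N)).trace).re := by
  have hNP : N * P = 0 := by
    have := congrArg conjTranspose hPN
    simpa [conjTranspose_mul, hP.isHermitian.eq, hN.isHermitian.eq] using this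
  have key : ∀ W : Matrix n n ℂ, (W * liebMap T m U W).trace =
      2 * (T * (W * W)).trace - U * ∑ i, (W * (m i * W * m i)).trace := by
    intro W
    rw [liebMap, mul_sub, trace_sub, mul_add, trace_add, mul_smul_comm, trace_smul, Finset.mul_sum,
      trace_sum, ← mul_assoc W T W, trace_mul_comm (W * T) W, ← mul_assoc W W T,
      trace_mul_comm (W * W) T, smul_eq_mul]
    ring
  have hsq : (P + N) * (P + N) = (P - N) * (P - N) := by
    simp only [mul_add, add_mul, mul_sub, sub_mul, hPN, hNP]; abel
  rw [conjTranspose_add, conjTranspose_sub, hP.isHermitian.eq, hN.isHermitian.eq, key, key, hsq,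
    Complex.sub_re, Complex.sub_re]
  refine sub_le_sub_left ?_ _
  rw [Complex.re_ofReal_mul, Complex.re_ofReal_mul]
  refine mul_le_mul_of_nonneg_left ?_ hU
  rw [Complex.re_sum, Complex.re_sum]
  refine Finset.sum_le_sum fun i _ => ?_
  have h1 : 0 ≤ (P * (m i * N * m i)).trace := by
    have := hN.mul_mul_conjTranspose_same (m i)
    rw [(hm i).eq] at this
    exact trace_mul_nonneg hP this
  have h2 : (N * (m i * P * m i)).trace = (P * (m i * N * m i)).trace := by
    have : N * (m i * P * m i) = (N * m i) * (P * m i) := by simp only [mul_assoc]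
    rw [this, trace_mul_comm]
    simp only [mul_assoc]
  have h3 : ((P + N) * (m i * (P + N) * m i)).trace -
      ((P - N) * (m i * (P - N) * m i)).trace = 4 * (P * (m i * N * m i)).trace := by
    simp only [mul_add, add_mul, mul_sub, sub_mul, trace_add, trace_sub, h2]
    ring
  have h4 := congrArg Complex.re h3
  have h5 := (Complex.nonneg_iff.mp h1).1
  simp only [Complex.sub_re, Complex.mul_re, Complex.re_ofNat, Complex.im_ofNat, zero_mul,
    sub_zero] at h4
  linarith

/-- The kernel of a positive semidefinite ground state is invariant under the hopping and all the
occupations. -/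
lemma posSemidef_kernel_invariant (hm : ∀ i, (m i).IsHermitian) (hU : 0 < U)
    {P : Matrix n n ℂ} (hP : P.PosSemidef) {E : ℂ} (hE : liebMap T m U P = E • P)
    {v : n → ℂ} (hv : P *ᵥ v = 0) :
    (∀ i, P *ᵥ (m i *ᵥ v) = 0) ∧ P *ᵥ (T *ᵥ v) = 0 := by
  have h1 : P *ᵥ (T *ᵥ v) - (U : ℂ) • ∑ i, m i *ᵥ (P *ᵥ (m i *ᵥ v)) = 0 := by
    have := congrArg (fun A => A *ᵥ v) hE
    simpa [liebMap, sub_mulVec, add_mulVec, smul_mulVec, hv, sum_mulVec, ← mulVec_mulVec]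
      using this
  have h2 : star v ⬝ᵥ (P *ᵥ (T *ᵥ v)) = 0 := by
    rw [dotProduct_mulVec, ← hP.isHermitian.eq, ← star_mulVec, hv]
    simp
  have h3 : ∀ i, star v ⬝ᵥ (m i *ᵥ (P *ᵥ (m i *ᵥ v))) =
      star (m i *ᵥ v) ⬝ᵥ (P *ᵥ (m i *ᵥ v)) := by
    intro i
    rw [dotProduct_mulVec, star_mulVec, (hm i).eq]
  have h4 : ∑ i, star (m i *ᵥ v) ⬝ᵥ (P *ᵥ (m i *ᵥ v)) = 0 := by
    have := congrArg (fun w => star v ⬝ᵥ w) h1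
    simp only [dotProduct_sub, h2, dotProduct_smul, dotProduct_sum, h3, dotProduct_zero, zero_sub,
      neg_eq_zero, smul_eq_mul, mul_eq_zero, Complex.ofReal_eq_zero] at this
    exact this.resolve_left hU.ne'
  have h5 : ∀ i, P *ᵥ (m i *ᵥ v) = 0 := by
    intro i
    rw [← hP.dotProduct_mulVec_zero_iff]
    exact (Finset.sum_eq_zero_iff_of_nonneg
      (fun i _ => hP.dotProduct_mulVec_nonneg (m i *ᵥ v))).mp h4 i (Finset.mem_univ i)
  refine ⟨h5, ?_⟩
  simpa [h5] using h1

end Lieb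

/-! ### Irreducibility -/

variable {Λ : Type*} [Fintype Λ] [LinearOrder Λ]

/-- On a connected set of sites, any two sets of the same size are joined by a sequence of moves
of single elements along bonds. -/
lemma config_induction {t : Λ → Λ → ℝ} (connected : IsConnected t) (p : Finset Λ → Prop)
    (hp : ∀ S x y, y ∈ S → x ∉ S → t x y ≠ 0 → p S → p (insert x (S.erase y)))
    {S S' : Finset Λ} (hS : p S) (hcard : S.card = S'.card) : p S' := by
  have step : ∀ x y, Relation.ReflTransGen (fun u v => t u v ≠ 0) x y →
      ∀ S, y ∈ S → x ∉ S → p S → p (insert x (S.erase y)) := by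
    intro x y h
    induction h with
    | refl => intro S hy hx; exact absurd hy hx
    | @tail z y _ hzy ih =>
      intro S hy hx hpS
      by_cases hz : z ∈ S
      · -- the electron at `z` moves on to `x`, and the one at `y` takes its place
        rcases eq_or_ne z y with rfl | hne
        · exact ih S hy hx hpS
        have hxz : x ≠ z := fun h => hx (h ▸ hz)
        have hxy : x ≠ y := fun h => hx (h ▸ hy)
        have h1 := hp (insert x (S.erase z)) z y (by simp [hy, hne.symm]) (by simp [hxz.symm]) hzy
          (ih S hz hx hpS)
        convert h1 using 1
        ext w
        simp only [Finset.mem_insert, Finset.mem_erase]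
        by_cases hwz : w = z
        · subst hwz; simp [hz, hne]
        · by_cases hwx : w = x
          · subst hwx; simp [hxy]
          · simp [hwz, hwx]
      · have h1 := hp S z y hy hz hzy hpS
        rcases eq_or_ne z x with rfl | hne
        · exact h1
        have h2 := ih (insert z (S.erase y)) (by simp) (by simp [hne.symm, hx]) h1
        rwa [Finset.erase_insert (by simp [hz])] at h2
  induction h : (S \ S').card generalizing S with
  | zero =>
    have hsub : S ⊆ S' := by simpa using h
    rwa [← Finset.eq_of_subset_of_card_le hsub hcard.ge]
  | succ k ih =>
    have hne : (S \ S').Nonempty := by rw [← Finset.card_pos]; omega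
    have hne' : (S' \ S).Nonempty := by
      rw [← Finset.card_pos, ← Finset.card_sdiff_eq_card_sdiff_iff.mpr hcard]; omega
    obtain ⟨y, hy⟩ := hne
    obtain ⟨x, hx⟩ := hne'
    rw [Finset.mem_sdiff] at hx hy
    refine ih (step x y (connected x y) S hy.1 hx.2 hS) ?_ ?_
    · rw [Finset.card_insert_of_notMem (by simp [hx.2]), Finset.card_erase_of_mem hy.1, ← hcard]
      have := Finset.card_pos.mpr ⟨y, hy.1⟩
      omega
    · have : insert x (S.erase y) \ S' = (S \ S').erase y := by
        ext w
        simp only [Finset.mem_sdiff, Finset.mem_insert, Finset.mem_erase]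
        by_cases hwx : w = x
        · subst hwx; simp [hx.1, hx.2]
        · simp [hwx, and_assoc]
      rw [this, Finset.card_erase_of_mem (by simp [hy.1, hy.2]), h]
      simp

/-- The hopping matrix of spinless fermions. -/
noncomputable def hop (t : Λ → Λ → ℝ) : Matrix (Finset Λ) (Finset Λ) ℂ :=
  ∑ x, ∑ y, (t x y : ℂ) • (cre x * (cre y)ᴴ)

lemma cre_mul_ann_apply (u v : Λ) (S' S : Finset Λ) :
    (cre u * (cre v)ᴴ) S' S = if u ∈ S' ∧ v ∉ S'.erase u ∧ insert v (S'.erase u) = S then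
      jwSign u S' * jwSign v (S'.erase u) else 0 := by
  rw [← mul_one (cre v)ᴴ, cre_mul_apply, ann_mul_apply, Matrix.one_apply]
  by_cases h1 : u ∈ S' <;> by_cases h2 : v ∈ S'.erase u <;>
    by_cases h3 : insert v (S'.erase u) = S <;> simp [h1, h2, h3]

lemma hop_apply_ne_zero {t : Λ → Λ → ℝ} {S : Finset Λ} {x y : Λ} (hy : y ∈ S) (hx : x ∉ S)
    (hxy : t x y ≠ 0) : hop t (insert x (S.erase y)) S ≠ 0 := by
  have hne : y ≠ x := fun h => hx (h ▸ hy)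
  -- only the term that moves the particle from `y` to `x` contributes
  have key : ∀ u v, (cre u * (cre v)ᴴ) (insert x (S.erase y)) S ≠ 0 → u = x ∧ v = y := by
    intro u v h
    rw [cre_mul_ann_apply, ne_eq, ite_eq_right_iff, Classical.not_imp] at h
    obtain ⟨⟨h1, h2, h3⟩, -⟩ := h
    have hyv : v = y := by
      have := h3 ▸ hy
      simp only [Finset.mem_insert, Finset.mem_erase] at this
      tauto
    refine ⟨?_, hyv⟩
    by_contra hux
    have h4 : u ∈ S ∧ u ≠ y := by
      simp only [Finset.mem_insert, Finset.mem_erase] at h1; tauto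
    have := h3 ▸ h4.1
    simp only [Finset.mem_insert, Finset.mem_erase] at this
    exact h4.2 (by rcases this with h | h <;> [exact h.trans hyv; exact absurd rfl h.1])
  rw [hop, Matrix.sum_apply, Finset.sum_eq_single x, Matrix.sum_apply, Finset.sum_eq_single y,
    Matrix.smul_apply, cre_mul_ann_apply, if_pos]
  · exact smul_ne_zero (by exact_mod_cast hxy) (mul_ne_zero (jwSign_ne_zero _ _)
      (jwSign_ne_zero _ _))
  · have : x ∉ S.erase y := by simp [hx]
    simp [Finset.erase_insert this, Finset.insert_erase hy]
  · intro v _ hv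
    by_contra h
    exact hv (key x v fun h' => h (by simp [h'])).2
  · simp
  · intro u _ hu
    rw [Matrix.sum_apply]
    refine Finset.sum_eq_zero fun v _ => ?_
    by_contra h
    exact hu (key u v fun h' => h (by simp [h'])).1
  · simp

lemma occ_mulVec_apply (x : Λ) (v : Finset Λ → ℂ) (S : Finset Λ) :
    (occ x *ᵥ v) S = if x ∈ S then v S else 0 := by
  rw [occ, Matrix.mulVec_diagonal]; split_ifs <;> simp

/-- The occupations and the hopping act irreducibly on the vectors with a fixed number of
particles. -/
lemma irreducible {t : Λ → Λ → ℝ} (connected : IsConnected t)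
    (K : Submodule ℂ (Finset Λ → ℂ)) (hocc : ∀ x, ∀ v ∈ K, occ x *ᵥ v ∈ K)
    (hhop : ∀ v ∈ K, hop t *ᵥ v ∈ K) {v : Finset Λ → ℂ} (hv : v ∈ K) {S S' : Finset Λ}
    (hS : v S ≠ 0) (hcard : S.card = S'.card) : Pi.single S' 1 ∈ K := by
  -- the occupations separate the basis vectors
  have sep : ∀ w ∈ K, ∀ S, w S ≠ 0 → Pi.single S (1 : ℂ) ∈ K := by
    intro w hw S hS
    have h : ∀ X : Finset Λ, (fun R => if R ∩ X = S ∩ X then w R else 0) ∈ K := by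
      intro X
      induction X using Finset.induction_on with
      | empty => simpa using hw
      | @insert x X _ ih =>
        have e : (fun R => if R ∩ insert x X = S ∩ insert x X then w R else 0) =
            if x ∈ S then occ x *ᵥ (fun R => if R ∩ X = S ∩ X then w R else 0)
            else (fun R => if R ∩ X = S ∩ X then w R else 0) -
              occ x *ᵥ (fun R => if R ∩ X = S ∩ X then w R else 0) := by
          have hiff : ∀ R, R ∩ insert x X = S ∩ insert x X ↔
              (x ∈ R ↔ x ∈ S) ∧ R ∩ X = S ∩ X := by
            intro R
            simp only [Finset.ext_iff, Finset.mem_inter, Finset.mem_insert]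
            constructor
            · intro h
              refine ⟨by simpa using h x, fun a => ?_⟩
              have := h a; tauto
            · rintro ⟨h1, h2⟩ a
              have := h2 a
              by_cases ha : a = x
              · subst ha; tauto
              · tauto
          funext R
          simp only [hiff]
          by_cases hx : x ∈ S
          · rw [if_pos hx, occ_mulVec_apply]
            by_cases hR : x ∈ R <;> simp [hx, hR]
          · rw [if_neg hx, Pi.sub_apply, occ_mulVec_apply]
            by_cases hR : x ∈ R <;> simp [hx, hR]
        rw [e]
        split_ifs
        · exact hocc x _ ih
        · exact K.sub_mem ih (hocc x _ ih)
    have h2 : Pi.single S (1 : ℂ) = (w S)⁻¹ • fun R => if R ∩ Finset.univ = S ∩ Finset.univ then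
        w R else 0 := by
      funext R
      by_cases hR : R = S
      · subst hR; simp [hS]
      · simp [hR]
    rw [h2]
    exact K.smul_mem _ (h _)
  refine config_induction connected (fun S => Pi.single S (1 : ℂ) ∈ K) ?_ (sep v hv S hS) hcard
  intro R x y hy hx hxy hR
  refine sep _ (hhop _ hR) _ ?_
  simpa using hop_apply_ne_zero hy hx hxy

end Hubbard

/-! ### Ground states of the attractive model -/

namespace Hubbard

open Matrix

variable {Λ : Type*} [Fintype Λ] [LinearOrder Λ]

/-- The particle number of spinless fermions. -/
noncomputable def num (Λ : Type*) [Fintype Λ] [LinearOrder Λ] :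
    Matrix (Finset Λ) (Finset Λ) ℂ :=
  ∑ x : Λ, occ x

lemma num_eq : num Λ = Matrix.diagonal fun S => (S.card : ℂ) := by
  have : num Λ = Matrix.diagonal (∑ x : Λ, fun S : Finset Λ => if x ∈ S then (1 : ℂ) else 0) := by
    simp only [num, occ]
    exact (map_sum (Matrix.diagonalAddMonoidHom (Finset Λ) ℂ) _ _).symm
  rw [this]
  congr 1
  funext S
  simp [Finset.sum_apply]

lemma num_isHermitian : (num Λ).IsHermitian := by
  rw [num_eq, Matrix.isHermitian_diagonal_iff]
  intro S
  simp [IsSelfAdjoint]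

lemma occ_isHermitian (x : Λ) : (occ x).IsHermitian := by
  rw [occ, Matrix.isHermitian_diagonal_iff]
  intro S
  split_ifs <;> simp [IsSelfAdjoint]

lemma num_mul_cre (x : Λ) : num Λ * cre x = cre x * num Λ + cre x := by
  ext S T
  rw [Matrix.add_apply, num_eq, Matrix.diagonal_mul, Matrix.mul_diagonal]
  simp only [cre, of_apply]
  split_ifs with h
  · rw [h.2, Finset.card_insert_of_notMem h.1]; push_cast; ring
  · simp

lemma ann_mul_num (x : Λ) : (cre x)ᴴ * num Λ = num Λ * (cre x)ᴴ + (cre x)ᴴ := by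
  have := congrArg conjTranspose (num_mul_cre x)
  simpa [conjTranspose_mul, num_isHermitian.eq] using this

lemma commute_num_cre_mul_ann (x y : Λ) : Commute (num Λ) (cre x * (cre y)ᴴ) := by
  rw [commute_iff_eq, ← mul_assoc, num_mul_cre, mul_assoc (cre x), ann_mul_num, mul_add, add_mul,
    mul_assoc]

lemma commute_num_hop (t : Λ → Λ → ℝ) : Commute (num Λ) (hop t) :=
  Commute.sum_right _ _ _ fun x _ => Commute.sum_right _ _ _ fun y _ =>
    (commute_num_cre_mul_ann x y).smul_right _

lemma commute_num_occ (x : Λ) : Commute (num Λ) (occ x) := by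
  rw [← cre_mul_ann_self]
  exact commute_num_cre_mul_ann x x

lemma hop_isHermitian {t : Λ → Λ → ℝ} (ht : ∀ x y, t x y = t y x) : (hop t).IsHermitian := by
  rw [Matrix.IsHermitian, hop]
  simp only [conjTranspose_sum, conjTranspose_smul, conjTranspose_mul, conjTranspose_conjTranspose,
    Complex.star_def, Complex.conj_ofReal]
  rw [Finset.sum_comm]
  simp only [ht]

/-- The Hamiltonian of the attractive Hubbard model on the matrices `W` that commute with the
particle number, which are those of the states at half filling. Half of the chemical
potential `U` that comes from the particle-hole transformation is given to each spin. -/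
noncomputable def attractive (t : Λ → Λ → ℝ) (U : ℝ) (W : Matrix (Finset Λ) (Finset Λ) ℂ) :
    Matrix (Finset Λ) (Finset Λ) ℂ :=
  liebMap (hop t + ((U / 2 : ℝ) : ℂ) • num Λ) occ U W

/-- The energy `E` is the lowest one at half filling, stated as the consequence which the proof
uses: a matrix whose energy is at most `E` is an eigenvector. -/
def VariationalPrinciple (t : Λ → Λ → ℝ) (U E : ℝ) : Prop :=
  ∀ W : Matrix (Finset Λ) (Finset Λ) ℂ, Commute (num Λ) W →
    ((Wᴴ * attractive t U W).trace).re ≤ E * ((Wᴴ * W).trace).re →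
      attractive t U W = (E : ℂ) • W

/-- `W` is a coefficient matrix of a state with `M` electrons of each spin on which the attractive
Hubbard Hamiltonian takes the value `E`. -/
structure IsEigenBlock (t : Λ → Λ → ℝ) (U E : ℝ) (M : ℕ)
    (W : Matrix (Finset Λ) (Finset Λ) ℂ) : Prop where
  eigen : attractive t U W = (E : ℂ) • W
  num_mul : num Λ * W = (M : ℂ) • W
  mul_num : W * num Λ = (M : ℂ) • W

namespace IsEigenBlock

variable {t : Λ → Λ → ℝ} {U E : ℝ} {M : ℕ} {V W : Matrix (Finset Λ) (Finset Λ) ℂ}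

lemma add (hV : IsEigenBlock t U E M V) (hW : IsEigenBlock t U E M W) :
    IsEigenBlock t U E M (V + W) where
  eigen := by
    have h1 := hV.eigen
    have h2 := hW.eigen
    unfold attractive at *
    rw [liebMap_add, h1, h2, smul_add]
  num_mul := by rw [mul_add, hV.num_mul, hW.num_mul, smul_add]
  mul_num := by rw [add_mul, hV.mul_num, hW.mul_num, smul_add]

lemma smul (c : ℂ) (hW : IsEigenBlock t U E M W) : IsEigenBlock t U E M (c • W) where
  eigen := by
    have h2 := hW.eigen
    unfold attractive at *
    rw [liebMap_smul, h2, smul_comm]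
  num_mul := by rw [mul_smul_comm, hW.num_mul, smul_comm]
  mul_num := by rw [smul_mul_assoc, hW.mul_num, smul_comm]

lemma conjTranspose (ht : ∀ x y, t x y = t y x) (hW : IsEigenBlock t U E M W) :
    IsEigenBlock t U E M Wᴴ where
  eigen := by
    have hT : (hop t + ((U / 2 : ℝ) : ℂ) • num Λ).IsHermitian := by
      refine (hop_isHermitian ht).add ?_
      rw [Matrix.IsHermitian, conjTranspose_smul, num_isHermitian.eq, Complex.star_def,
        Complex.conj_ofReal]
    have h2 := hW.eigen
    unfold attractive at *
    rw [liebMap_conjTranspose hT occ_isHermitian, h2]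
    simp
  num_mul := by
    have := congrArg Matrix.conjTranspose hW.mul_num
    simpa [conjTranspose_mul, num_isHermitian.eq] using this
  mul_num := by
    have := congrArg Matrix.conjTranspose hW.num_mul
    simpa [conjTranspose_mul, num_isHermitian.eq] using this

lemma apply_eq_zero_of_left (hW : IsEigenBlock t U E M W) {S : Finset Λ} (hS : S.card ≠ M)
    (T : Finset Λ) : W S T = 0 := by
  have := congrFun (congrFun hW.num_mul S) T
  rw [num_eq, Matrix.diagonal_mul, Matrix.smul_apply, smul_eq_mul] at this
  by_contra h
  exact hS (by exact_mod_cast mul_right_cancel₀ h this)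

lemma apply_eq_zero_of_right (hW : IsEigenBlock t U E M W) (S : Finset Λ) {T : Finset Λ}
    (hT : T.card ≠ M) : W S T = 0 := by
  have := congrFun (congrFun hW.mul_num S) T
  rw [num_eq, Matrix.mul_diagonal, Matrix.smul_apply, smul_eq_mul, mul_comm] at this
  by_contra h
  exact hT (by exact_mod_cast mul_right_cancel₀ h this)

/-- A nonzero positive semidefinite ground state is nondegenerate on the vectors with `M`
particles. -/
lemma apply_eq_zero_of_mulVec (connected : IsConnected t) (hU : 0 < U)
    (hW : IsEigenBlock t U E M W) (hpos : W.PosSemidef) (hne : W ≠ 0) {v : Finset Λ → ℂ}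
    (hv : W *ᵥ v = 0) {S : Finset Λ} (hS : S.card = M) : v S = 0 := by
  by_contra hvS
  apply hne
  have hinv : ∀ w : Finset Λ → ℂ, W *ᵥ w = 0 →
      (∀ x, W *ᵥ (occ x *ᵥ w) = 0) ∧ W *ᵥ (hop t *ᵥ w) = 0 := by
    intro w hw
    obtain ⟨h1, h2⟩ := posSemidef_kernel_invariant occ_isHermitian hU hpos hW.eigen hw
    refine ⟨h1, ?_⟩
    have h3 : W *ᵥ (num Λ *ᵥ w) = 0 := by
      rw [num, sum_mulVec, mulVec_sum]
      exact Finset.sum_eq_zero fun x _ => h1 x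
    simpa [add_mulVec, mulVec_add, smul_mulVec, mulVec_smul, h3] using h2
  have hK : ∀ w, w ∈ LinearMap.ker W.mulVecLin ↔ W *ᵥ w = 0 := fun w => by
    rw [LinearMap.mem_ker, Matrix.mulVecLin_apply]
  ext R T
  by_cases hT : T.card = M
  · have := irreducible connected (LinearMap.ker W.mulVecLin)
      (fun x w hw => (hK _).2 ((hinv w ((hK _).1 hw)).1 x))
      (fun w hw => (hK _).2 (hinv w ((hK _).1 hw)).2) ((hK v).2 hv) hvS (hS.trans hT.symm)
    have h := congrFun ((hK _).1 this) R
    simpa using h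
  · exact hW.apply_eq_zero_of_right R hT

lemma eq_zero_of_mul_eq_zero (connected : IsConnected t) (hU : 0 < U)
    (hW : IsEigenBlock t U E M W) (hpos : W.PosSemidef) (hne : W ≠ 0)
    {A : Matrix (Finset Λ) (Finset Λ) ℂ} (hA : W * A = 0) {S : Finset Λ} (hS : S.card = M)
    (T : Finset Λ) : A S T = 0 := by
  refine hW.apply_eq_zero_of_mulVec connected hU hpos hne (v := fun R => A R T) ?_ hS
  funext R
  exact congrFun (congrFun hA R) T

/-- Every operator that does not vanish on the vectors with `M` particles has a nonzero pair
correlation in a positive ground state. -/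
lemma trace_sandwich_ne_zero (connected : IsConnected t) (hU : 0 < U)
    (hW : IsEigenBlock t U E M W) (hpos : W.PosSemidef) (hne : W ≠ 0)
    {A : Matrix (Finset Λ) (Finset Λ) ℂ} (hA : Commute (num Λ) A) {S T : Finset Λ}
    (hS : S.card = M) (hST : A S T ≠ 0) : (W * (A * W * Aᴴ)).trace ≠ 0 := by
  intro h
  have h1 := sandwich_eq_zero hpos h
  rw [mul_assoc] at h1
  have h2 : A * W = 0 := by
    ext R R'
    by_cases hR : R.card = M
    · exact hW.eq_zero_of_mul_eq_zero connected hU hpos hne h1 hR R'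
    · have h3 : num Λ * (A * W) = (M : ℂ) • (A * W) := by
        rw [← mul_assoc, hA.eq, mul_assoc, hW.num_mul, mul_smul_comm]
      have := congrFun (congrFun h3 R) R'
      rw [num_eq, Matrix.diagonal_mul, Matrix.smul_apply, smul_eq_mul] at this
      by_contra h
      exact hR (by exact_mod_cast mul_right_cancel₀ h this)
  have hT : T.card = M := by
    have := congrFun (congrFun hA.eq S) T
    rw [num_eq, Matrix.diagonal_mul, Matrix.mul_diagonal, mul_comm] at this
    have := mul_left_cancel₀ hST this
    rw [← hS]; exact_mod_cast this.symm
  have h4 : W * Aᴴ = 0 := by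
    have := congrArg Matrix.conjTranspose h2
    simpa [conjTranspose_mul, hpos.isHermitian.eq] using this
  have := hW.eq_zero_of_mul_eq_zero connected hU hpos hne h4 hT S
  rw [conjTranspose_apply, star_eq_zero] at this
  exact hST this

/-- The positive and the negative part of a Hermitian ground state are ground states. -/
lemma of_sub (hU : 0 < U)
    (hvar : VariationalPrinciple t U E)
    {P N : Matrix (Finset Λ) (Finset Λ) ℂ} (hP : P.PosSemidef) (hN : N.PosSemidef)
    (hPN : P * N = 0) (hW : IsEigenBlock t U E M (P - N)) :
    IsEigenBlock t U E M P ∧ IsEigenBlock t U E M N := by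
  have hNP : N * P = 0 := by
    have := congrArg Matrix.conjTranspose hPN
    simpa [conjTranspose_mul, hP.isHermitian.eq, hN.isHermitian.eq] using this
  -- the kernel of `P - N` is the intersection of the kernels of `P` and of `N`
  have hker : P * (num Λ - (M : ℂ) • 1) = 0 ∧ N * (num Λ - (M : ℂ) • 1) = 0 := by
    set A : Matrix (Finset Λ) (Finset Λ) ℂ := num Λ - (M : ℂ) • 1 with hA
    have h1 : (P - N) * A = 0 := by
      rw [hA, mul_sub, hW.mul_num]; simp
    rw [sub_mul, sub_eq_zero] at h1
    have h2 : (P * A)ᴴ * (P * A) = 0 := by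
      rw [conjTranspose_mul, hP.isHermitian.eq, mul_assoc, h1, ← mul_assoc P, hPN]
      simp
    have h3 := conjTranspose_mul_self_eq_zero.mp h2
    exact ⟨h3, h1 ▸ h3⟩
  have hPr : P * num Λ = (M : ℂ) • P := by
    simpa [mul_sub, sub_eq_zero] using hker.1
  have hNr : N * num Λ = (M : ℂ) • N := by
    simpa [mul_sub, sub_eq_zero] using hker.2
  have hPl : num Λ * P = (M : ℂ) • P := by
    have := congrArg Matrix.conjTranspose hPr
    simpa [conjTranspose_mul, num_isHermitian.eq, hP.isHermitian.eq] using this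
  have hNl : num Λ * N = (M : ℂ) • N := by
    have := congrArg Matrix.conjTranspose hNr
    simpa [conjTranspose_mul, num_isHermitian.eq, hN.isHermitian.eq] using this
  have hR : IsEigenBlock t U E M (P + N) := by
    refine ⟨hvar _ ?_ ?_, by rw [mul_add, hPl, hNl, smul_add], by rw [add_mul, hPr, hNr, smul_add]⟩
    · rw [commute_iff_eq, mul_add, add_mul, hPl, hNl, hPr, hNr]
    · refine (energy_abs_le occ_isHermitian hU.le hP hN hPN).trans ?_
      have h1 := hW.eigen
      unfold attractive at h1
      have h2 : (P + N)ᴴ * (P + N) = (P - N)ᴴ * (P - N) := by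
        rw [conjTranspose_add, conjTranspose_sub, hP.isHermitian.eq, hN.isHermitian.eq]
        simp only [mul_add, add_mul, mul_sub, sub_mul, hPN, hNP]; abel
      rw [h1, mul_smul_comm, trace_smul, h2, smul_eq_mul, Complex.re_ofReal_mul]
  constructor
  · have := (hR.add hW).smul (1 / 2)
    convert this using 1
    module
  · have := (hR.add (hW.smul (-1))).smul (1 / 2)
    convert this using 1
    module

/-- A Hermitian ground state is positive or negative semidefinite, so it vanishes if its trace
vanishes. -/
lemma eq_zero_of_trace_eq_zero (connected : IsConnected t) (hU : 0 < U)
    (hvar : VariationalPrinciple t U E)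
    (hW : IsEigenBlock t U E M W) (hH : W.IsHermitian) (htr : W.trace = 0) : W = 0 := by
  obtain ⟨P, N, hP, hN, hPN, rfl⟩ := exists_posSemidef_sub hH
  obtain ⟨h1, h2⟩ := of_sub hU hvar hP hN hPN hW
  by_cases hP0 : P = 0
  · subst hP0
    rw [zero_sub, trace_neg, neg_eq_zero, hN.trace_eq_zero_iff] at htr
    simp [htr]
  · have hN0 : N = 0 := by
      ext S T
      by_cases hS : S.card = M
      · exact h1.eq_zero_of_mul_eq_zero connected hU hP hP0 hPN hS T
      · exact h2.apply_eq_zero_of_left hS T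
    subst hN0
    rw [sub_zero, hP.trace_eq_zero_iff] at htr
    exact absurd htr hP0

end IsEigenBlock

/-- In each block, the ground states are the multiples of one positive semidefinite matrix. -/
lemma exists_posSemidef_spanning {t : Λ → Λ → ℝ} (ht : ∀ x y, t x y = t y x)
    (connected : IsConnected t) {U E : ℝ} (hU : 0 < U)
    (hvar : VariationalPrinciple t U E) (M : ℕ) :
    ∃ P : Matrix (Finset Λ) (Finset Λ) ℂ, P.PosSemidef ∧ IsEigenBlock t U E M P ∧
      ∀ W, IsEigenBlock t U E M W → ∃ c : ℂ, W = c • P := by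
  -- a matrix with vanishing trace splits into two Hermitian ones with vanishing traces
  have hzero : ∀ W, IsEigenBlock t U E M W → W.trace = 0 → W = 0 := by
    intro W hW htr
    have htr' : Wᴴ.trace = 0 := by rw [trace_conjTranspose, htr, star_zero]
    have h1 := (hW.add (hW.conjTranspose ht)).eq_zero_of_trace_eq_zero connected hU hvar
      (isHermitian_add_transpose_self W) (by rw [trace_add, htr, htr', add_zero])
    have h2 := ((hW.smul Complex.I).add ((hW.smul Complex.I).conjTranspose ht)
      ).eq_zero_of_trace_eq_zero connected hU hvar
      (isHermitian_add_transpose_self _)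
      (by rw [trace_add, trace_conjTranspose, trace_smul, htr]; simp)
    have h3 : Wᴴ = -W := by rw [eq_neg_iff_add_eq_zero, add_comm]; exact h1
    rw [conjTranspose_smul, h3] at h2
    have h4 : (2 * Complex.I) • W = 0 := by
      rw [← h2, Complex.star_def, Complex.conj_I]; module
    exact (smul_eq_zero.mp h4).resolve_left (by simp)
  by_cases hex : ∃ W, IsEigenBlock t U E M W ∧ W ≠ 0
  · obtain ⟨W, hW, hW0⟩ := hex
    obtain ⟨V, hV, hVH, hV0⟩ : ∃ V, IsEigenBlock t U E M V ∧ V.IsHermitian ∧ V ≠ 0 := by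
      by_cases h : W + Wᴴ = 0
      · refine ⟨Complex.I • W, hW.smul _, ?_, smul_ne_zero Complex.I_ne_zero hW0⟩
        rw [add_comm, add_eq_zero_iff_eq_neg] at h
        rw [Matrix.IsHermitian, conjTranspose_smul, h, Complex.star_def, Complex.conj_I]
        simp
      · exact ⟨_, hW.add (hW.conjTranspose ht), isHermitian_add_transpose_self W, h⟩
    obtain ⟨P, hP, hPB, hP0⟩ : ∃ P : Matrix (Finset Λ) (Finset Λ) ℂ, P.PosSemidef ∧
        IsEigenBlock t U E M P ∧ P ≠ 0 := by
      obtain ⟨P, N, hP, hN, hPN, rfl⟩ := exists_posSemidef_sub hVH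
      obtain ⟨h1, h2⟩ := IsEigenBlock.of_sub hU hvar hP hN hPN hV
      by_cases hP0 : P = 0
      · exact ⟨N, hN, h2, by rintro rfl; exact hV0 (by simp [hP0])⟩
      · exact ⟨P, hP, h1, hP0⟩
    have htr : P.trace ≠ 0 := fun h => hP0 (hP.trace_eq_zero_iff.mp h)
    refine ⟨P, hP, hPB, fun W hW => ⟨W.trace / P.trace, ?_⟩⟩
    have := hzero _ (hW.add (hPB.smul (-(W.trace / P.trace)))) (by
      rw [trace_add, trace_smul, smul_eq_mul]; field_simp; ring)
    rw [neg_smul, ← sub_eq_add_neg, sub_eq_zero] at this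
    exact this
  · push Not at hex
    refine ⟨0, Matrix.PosSemidef.zero, ⟨?_, by simp, by simp⟩, fun W hW => ⟨0, by simp [hex W hW]⟩⟩
    simp [attractive, liebMap]

end Hubbard

/-! ### Ground states of the repulsive model at half filling -/

namespace Hubbard

open Matrix

/-- A state of an invariant subspace which attains the lowest energy of that subspace is an
eigenvector. -/
lemma eigen_of_minimal {F : Type*} [NormedAddCommGroup F] [InnerProductSpace ℂ F]
    {H : Module.End ℂ F} (hH : ∀ u v, inner ℂ (H u) v = inner ℂ u (H v)) {V : Submodule ℂ F}
    (hV : ∀ v ∈ V, H v ∈ V) {E : ℝ} (hmin : ∀ v ∈ V, E * ‖v‖ ^ 2 ≤ (inner ℂ v (H v)).re)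
    {u : F} (hu : u ∈ V) (hle : (inner ℂ u (H u)).re ≤ E * ‖u‖ ^ 2) : H u = (E : ℂ) • u := by
  set D : F := H u - (E : ℂ) • u with hD
  have hDV : D ∈ V := V.sub_mem (hV u hu) (V.smul_mem _ hu)
  -- the energy excess is a nonnegative quadratic polynomial along the line through `u` towards `D`
  have hq : ∀ s : ℝ, 0 ≤ ((inner ℂ D (H D)).re - E * ‖D‖ ^ 2) * (s * s) + (2 * ‖D‖ ^ 2) * s +
      ((inner ℂ u (H u)).re - E * ‖u‖ ^ 2) := by
    intro s
    have h1 := hmin (u + (s : ℂ) • D) (V.add_mem hu (V.smul_mem _ hDV))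
    have h2 : ∀ w : F, ((‖w‖ ^ 2 : ℝ) : ℂ) = inner ℂ w w := fun w => by
      rw [inner_self_eq_norm_sq_to_K]; push_cast; rfl
    have h3 : ∀ w : F, ‖w‖ ^ 2 = (inner ℂ w w).re := fun w => by
      rw [← h2, Complex.ofReal_re]
    have h4 : (inner ℂ D (H u)).re = ‖D‖ ^ 2 + E * (inner ℂ D u).re := by
      have : H u = D + (E : ℂ) • u := by rw [hD]; abel
      rw [this, inner_add_right, inner_smul_right, Complex.add_re, Complex.re_ofReal_mul, h3]
    have h5 : (inner ℂ u (H D)).re = (inner ℂ D (H u)).re := by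
      rw [← hH, ← inner_conj_symm, Complex.conj_re]
    have h6 : (inner ℂ u D).re = (inner ℂ D u).re := by
      rw [← inner_conj_symm, Complex.conj_re]
    rw [h3 (u + _)] at h1
    simp only [map_add, map_smul, inner_add_left, inner_add_right, inner_smul_left,
      inner_smul_right, Complex.add_re, Complex.re_ofReal_mul, Complex.conj_ofReal, h4, h5, h6]
      at h1
    rw [← h3, ← h3] at h1
    nlinarith
  have hd := discrim_le_zero hq
  have h0 : (inner ℂ u (H u)).re - E * ‖u‖ ^ 2 = 0 :=
    le_antisymm (by linarith) (by linarith [hmin u hu])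
  rw [discrim, h0, mul_zero, sub_zero] at hd
  have : ‖D‖ ^ 2 = 0 := by nlinarith [sq_nonneg (2 * ‖D‖ ^ 2)]
  have : D = 0 := by simpa using this
  rwa [hD, sub_eq_zero] at this

variable {Λ : Type*} [Fintype Λ] [LinearOrder Λ]

lemma coeffMatrix_transfer_zero (x y : Λ) (Φ : Fock Λ) :
    coeffMatrix (transfer x 0 y 0 Φ) = cre x * (cre y)ᴴ * coeffMatrix Φ := by
  rw [transfer, Module.End.mul_apply, coeffMatrix_create_zero, coeffMatrix_annihilate_zero,
    mul_assoc]

lemma coeffMatrix_transfer_one (x y : Λ) (Φ : Fock Λ) :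
    coeffMatrix (transfer x 1 y 1 Φ) = coeffMatrix Φ * (cre y * (cre x)ᴴ) := by
  rw [transfer, Module.End.mul_apply, coeffMatrix_create_one, coeffMatrix_annihilate_one,
    cre_transpose]
  simp only [mul_assoc, parity_mul_parity_mul]

lemma coeffMatrix_flips (x y : Λ) (Φ : Fock Λ) :
    coeffMatrix ((transfer x 0 x 1 * transfer y 1 y 0) Φ) =
      cre x * (cre y)ᴴ * coeffMatrix Φ * ((cre y)ᴴ * cre x) := by
  simp only [transfer, Module.End.mul_apply, coeffMatrix_create_one, coeffMatrix_annihilate_one,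
    coeffMatrix_create_zero, coeffMatrix_annihilate_zero, cre_transpose]
  simp only [mul_assoc, parity_mul_parity_mul]

/-- The coefficient matrix of a state after a particle-hole transformation of the down
electrons. -/
noncomputable def flip (ε : Λ → ℂ) (Φ : Fock Λ) : Matrix (Finset Λ) (Finset Λ) ℂ :=
  coeffMatrix Φ * particleHole ε

section Flip

variable {ε : Λ → ℂ}

lemma ann_mul_cre_self (x : Λ) : (cre x)ᴴ * cre x = 1 - occ x := by
  have := ann_mul_cre x x
  rw [if_pos rfl, cre_mul_ann_self] at this
  exact eq_sub_of_add_eq this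

lemma flip_add (Φ Ψ : Fock Λ) : flip ε (Φ + Ψ) = flip ε Φ + flip ε Ψ := by
  rw [flip, map_add, add_mul, flip, flip]

lemma flip_sum {ι : Type*} (s : Finset ι) (f : ι → Fock Λ) :
    flip ε (∑ i ∈ s, f i) = ∑ i ∈ s, flip ε (f i) := by
  simp only [flip, map_sum, Finset.sum_mul]

lemma flip_smul (c : ℂ) (Φ : Fock Λ) : flip ε (c • Φ) = c • flip ε Φ := by
  rw [flip, map_smul, smul_mul_assoc, flip]

lemma flip_transfer_zero (x y : Λ) (Φ : Fock Λ) :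
    flip ε (transfer x 0 y 0 Φ) = cre x * (cre y)ᴴ * flip ε Φ := by
  rw [flip, coeffMatrix_transfer_zero, mul_assoc, flip]

lemma flip_number_zero (x : Λ) (Φ : Fock Λ) :
    flip ε (transfer x 0 x 0 Φ) = occ x * flip ε Φ := by
  rw [flip_transfer_zero, cre_mul_ann_self]

lemma flip_total_zero (Φ : Fock Λ) : flip ε (total Λ 0 0 Φ) = num Λ * flip ε Φ := by
  rw [total, LinearMap.sum_apply, flip_sum, num, Finset.sum_mul]
  simp only [flip_number_zero]

variable (hε : ∀ x, ε x = 1 ∨ ε x = -1)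
include hε

lemma inner_eq_trace_flip (Φ Ψ : Fock Λ) :
    inner ℂ Φ Ψ = ((flip ε Φ)ᴴ * flip ε Ψ).trace := by
  rw [inner_eq_trace, flip, flip, conjTranspose_mul, mul_assoc, trace_mul_comm (particleHole ε)ᴴ,
    mul_assoc, mul_assoc, particleHole_mul_conjTranspose hε, mul_one]

lemma exists_flip_eq (W : Matrix (Finset Λ) (Finset Λ) ℂ) : ∃ Φ : Fock Λ, flip ε Φ = W :=
  ⟨coeffMatrix.symm (W * (particleHole ε)ᴴ), by
    rw [flip, LinearEquiv.apply_symm_apply, mul_assoc, particleHole_conjTranspose_mul hε, mul_one]⟩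

lemma flip_injective : Function.Injective (flip ε) := by
  intro Φ Ψ h
  have := congrArg (fun A => A * (particleHole ε)ᴴ) h
  simp only [flip, mul_assoc, particleHole_mul_conjTranspose hε, mul_one] at this
  exact coeffMatrix.injective this

lemma cre_mul_ann_mul_particleHole (x y : Λ) :
    cre x * (cre y)ᴴ * particleHole ε = (ε x * ε y) • (particleHole ε * ((cre x)ᴴ * cre y)) := by
  rw [mul_assoc, ann_mul_particleHole hε, mul_smul_comm, ← mul_assoc, cre_mul_particleHole ε,
    smul_mul_assoc, smul_smul, mul_assoc, mul_comm (ε y)]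

lemma flip_transfer_one (x y : Λ) (Φ : Fock Λ) :
    flip ε (transfer x 1 y 1 Φ) = (ε x * ε y) • (flip ε Φ * ((cre y)ᴴ * cre x)) := by
  rw [flip, coeffMatrix_transfer_one, mul_assoc, cre_mul_ann_mul_particleHole hε, flip,
    mul_smul_comm, mul_assoc, mul_comm (ε x)]

lemma flip_number_one (x : Λ) (Φ : Fock Λ) :
    flip ε (transfer x 1 x 1 Φ) = flip ε Φ - flip ε Φ * occ x := by
  have h : ε x * ε x = 1 := by rcases hε x with h | h <;> simp [h]
  rw [flip_transfer_one hε, h, one_smul, ann_mul_cre_self, mul_sub, mul_one]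

/-- On a bond, the sublattice signs cancel the sign from exchanging the two operators, so the
transformed down electrons hop like the up electrons. -/
lemma flip_bond {x y : Λ} (hxy : ε x * ε y = -1) (Φ : Fock Λ) :
    flip ε (transfer x 1 y 1 Φ) = flip ε Φ * (cre x * (cre y)ᴴ) := by
  have hne : y ≠ x := by
    rintro rfl
    rcases hε y with h | h <;> norm_num [h] at hxy
  have h := ann_mul_cre y x
  rw [if_neg hne, add_eq_zero_iff_eq_neg] at h
  rw [flip_transfer_one hε, hxy, h, mul_neg, neg_smul, one_smul, neg_neg]

/-- The spin-flip correlation becomes the pair correlation of the attractive model. -/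
lemma flip_flips (x y : Λ) (Φ : Fock Λ) :
    flip ε ((transfer x 0 x 1 * transfer y 1 y 0) Φ) =
      (ε x * ε y) • (cre x * (cre y)ᴴ * flip ε Φ * (cre x * (cre y)ᴴ)ᴴ) := by
  have h : (cre y)ᴴ * cre x * particleHole ε =
      (ε x * ε y) • (particleHole ε * (cre y * (cre x)ᴴ)) := by
    rw [mul_assoc, cre_mul_particleHole ε, mul_smul_comm, ← mul_assoc, ann_mul_particleHole hε,
      smul_mul_assoc, smul_smul, mul_assoc]
  rw [flip, coeffMatrix_flips, mul_assoc _ _ (particleHole ε), h, flip, mul_smul_comm,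
    conjTranspose_mul, conjTranspose_conjTranspose]
  simp only [mul_assoc]

lemma flip_totalNumber (Φ : Fock Λ) :
    flip ε (totalNumber Λ Φ) =
      num Λ * flip ε Φ + ((Fintype.card Λ : ℂ) • flip ε Φ - flip ε Φ * num Λ) := by
  have h1 : flip ε (total Λ 1 1 Φ) = (Fintype.card Λ : ℂ) • flip ε Φ - flip ε Φ * num Λ := by
    rw [total, LinearMap.sum_apply, flip_sum, num, Finset.mul_sum]
    simp only [flip_number_one hε, Finset.sum_sub_distrib]
    simp [Nat.cast_smul_eq_nsmul]
  rw [totalNumber_eq, LinearMap.add_apply, ← h1, ← flip_total_zero, flip, map_add, add_mul]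
  rfl

/-- Half filling means that the two spins have equal particle numbers after the particle-hole
transformation. -/
lemma mem_sector_iff (Φ : Fock Λ) :
    Φ ∈ sector Λ (Fintype.card Λ) ↔ Commute (num Λ) (flip ε Φ) := by
  rw [sector, LinearMap.mem_ker, LinearMap.sub_apply, sub_eq_zero, LinearMap.smul_apply,
    Module.End.one_apply, ← (flip_injective hε).eq_iff, flip_totalNumber hε, flip_smul,
    commute_iff_eq, add_sub_left_comm, add_eq_left, sub_eq_zero]

lemma flip_hopping {t : Λ → Λ → ℝ} (hbip : ∀ x y, t x y ≠ 0 → ε x * ε y = -1) (Φ : Fock Λ) :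
    flip ε (hopping t Φ) = hop t * flip ε Φ + flip ε Φ * hop t := by
  have e : hopping t Φ = ∑ x : Λ, ∑ y : Λ,
      ((t x y : ℂ) • transfer x 0 y 0 Φ + (t x y : ℂ) • transfer x 1 y 1 Φ) := by
    simp only [hopping, LinearMap.sum_apply, Fin.sum_univ_two, transfer]
    rfl
  rw [e, hop, Finset.sum_mul, Finset.mul_sum, ← Finset.sum_add_distrib, flip_sum]
  refine Finset.sum_congr rfl fun x _ => ?_
  rw [Finset.sum_mul, Finset.mul_sum, ← Finset.sum_add_distrib, flip_sum]
  refine Finset.sum_congr rfl fun y _ => ?_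
  rw [flip_add, flip_smul, flip_smul, flip_transfer_zero, smul_mul_assoc,
    mul_smul_comm]
  by_cases h : t x y = 0
  · simp [h]
  · rw [flip_bond hε (hbip x y h)]

lemma flip_interaction (U : ℝ) (Φ : Fock Λ) :
    flip ε (interaction (fun _ => U) Φ) =
      (U : ℂ) • (num Λ * flip ε Φ - ∑ x : Λ, occ x * flip ε Φ * occ x) := by
  have e : interaction (fun _ => U) Φ =
      ∑ x : Λ, (U : ℂ) • transfer x 0 x 0 (transfer x 1 x 1 Φ) := by
    simp only [interaction, LinearMap.sum_apply]
    rfl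
  rw [e, num, Finset.sum_mul, ← Finset.sum_sub_distrib, Finset.smul_sum, flip_sum]
  refine Finset.sum_congr rfl fun x _ => ?_
  rw [flip_smul, flip_number_zero, flip_number_one hε, mul_sub, mul_assoc]

lemma flip_hamiltonian {t : Λ → Λ → ℝ} (hbip : ∀ x y, t x y ≠ 0 → ε x * ε y = -1) (U : ℝ)
    {Φ : Fock Λ} (hΦ : Commute (num Λ) (flip ε Φ)) :
    flip ε (hamiltonian t (fun _ => U) Φ) = attractive t U (flip ε Φ) := by
  rw [hamiltonian, LinearMap.add_apply, flip_add, flip_hopping hε hbip, flip_interaction hε,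
    attractive, liebMap, add_mul, mul_add, smul_mul_assoc, mul_smul_comm, ← hΦ.eq, smul_sub]
  push_cast
  module

end Flip

lemma mem_sector_total {Φ : Fock Λ} {N : ℕ} (hΦ : Φ ∈ sector Λ N) (σ τ : Fin 2) :
    total Λ σ τ Φ ∈ sector Λ N := by
  have hc : Commute (total Λ σ τ) (totalNumber Λ) := by
    rw [totalNumber_eq, commute_iff_eq, ← sub_eq_zero, mul_add, add_mul, add_sub_add_comm,
      total_commutator_total, total_commutator_total]
    fin_cases σ <;> fin_cases τ <;> simp
  rw [sector, LinearMap.mem_ker, LinearMap.sub_apply, sub_eq_zero] at hΦ ⊢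
  rw [← Module.End.mul_apply, ← hc.eq, Module.End.mul_apply, hΦ]
  simp

lemma hamiltonian_mem_sector {Φ : Fock Λ} {N : ℕ} (hΦ : Φ ∈ sector Λ N) (t : Λ → Λ → ℝ)
    (U : Λ → ℝ) : hamiltonian t U Φ ∈ sector Λ N := by
  have hc : Commute (hamiltonian t U) (totalNumber Λ) := by
    rw [totalNumber_eq]
    exact (commute_total_hamiltonian t U 0 0).symm.add_right
      (commute_total_hamiltonian t U 1 1).symm
  rw [sector, LinearMap.mem_ker, LinearMap.sub_apply, sub_eq_zero] at hΦ ⊢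
  rw [← Module.End.mul_apply, ← hc.eq, Module.End.mul_apply, hΦ]
  simp

/-- The space of the states at half filling with energy `E`. -/
noncomputable def energySpace (t : Λ → Λ → ℝ) (U E : ℝ) : Submodule ℂ (Fock Λ) :=
  sector Λ (Fintype.card Λ) ⊓ Module.End.eigenspace (hamiltonian t fun _ => U) (E : ℂ)

lemma mem_energySpace {t : Λ → Λ → ℝ} {U E : ℝ} {Φ : Fock Λ} :
    Φ ∈ energySpace t U E ↔ Φ ∈ sector Λ (Fintype.card Λ) ∧
      hamiltonian t (fun _ => U) Φ = (E : ℂ) • Φ := by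
  rw [energySpace, Submodule.mem_inf, Module.End.mem_eigenspace_iff]

lemma total_mem_energySpace {t : Λ → Λ → ℝ} {U E : ℝ} {Φ : Fock Λ}
    (hΦ : Φ ∈ energySpace t U E) (σ τ : Fin 2) : total Λ σ τ Φ ∈ energySpace t U E := by
  rw [mem_energySpace] at hΦ ⊢
  refine ⟨mem_sector_total hΦ.1 σ τ, ?_⟩
  rw [← Module.End.mul_apply, ← (commute_total_hamiltonian t _ σ τ).eq, Module.End.mul_apply, hΦ.2,
    map_smul]

/-- The projection onto the vectors of spinless fermions with `M` particles. -/
def blockProj (Λ : Type*) [Fintype Λ] [LinearOrder Λ] (M : ℕ) :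
    Matrix (Finset Λ) (Finset Λ) ℂ :=
  Matrix.diagonal fun S => if S.card = M then 1 else 0

lemma commute_blockProj {A : Matrix (Finset Λ) (Finset Λ) ℂ} (hA : Commute (num Λ) A) (M : ℕ) :
    Commute (blockProj Λ M) A := by
  rw [commute_iff_eq]
  ext S T
  have := congrFun (congrFun hA.eq S) T
  rw [num_eq, Matrix.diagonal_mul, Matrix.mul_diagonal, mul_comm] at this
  rw [blockProj, Matrix.diagonal_mul, Matrix.mul_diagonal]
  by_cases h : A S T = 0
  · simp [h]
  · have hc : S.card = T.card := by exact_mod_cast mul_left_cancel₀ h this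
    simp [hc, mul_comm]

lemma sum_blockProj : ∑ M ∈ Finset.range (Fintype.card Λ + 1), blockProj Λ M = 1 := by
  ext S T
  rw [Matrix.sum_apply]
  by_cases h : S = T
  · subst h
    simp [blockProj, Finset.card_le_univ]
  · simp [blockProj, h]

/-- The components of a ground state with given particle numbers are ground states. -/
lemma isEigenBlock_blockProj_mul {t : Λ → Λ → ℝ} {U E : ℝ}
    {W : Matrix (Finset Λ) (Finset Λ) ℂ} (hW : Commute (num Λ) W)
    (hE : attractive t U W = (E : ℂ) • W) (M : ℕ) :
    IsEigenBlock t U E M (blockProj Λ M * W) := by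
  have hnum : num Λ * blockProj Λ M = (M : ℂ) • blockProj Λ M := by
    ext S T
    rw [num_eq, Matrix.diagonal_mul, Matrix.smul_apply, smul_eq_mul, blockProj]
    by_cases h : S = T
    · subst h
      by_cases h' : S.card = M <;> simp [h']
    · simp [h]
  have h1 : num Λ * (blockProj Λ M * W) = (M : ℂ) • (blockProj Λ M * W) := by
    rw [← mul_assoc, hnum, smul_mul_assoc]
  refine ⟨?_, h1, ?_⟩
  · have hT : Commute (blockProj Λ M) (hop t + ((U / 2 : ℝ) : ℂ) • num Λ) :=
      commute_blockProj ((commute_num_hop t).add_right ((Commute.refl _).smul_right _)) M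
    have hocc : ∀ x : Λ, Commute (blockProj Λ M) (occ x) := fun x =>
      commute_blockProj (commute_num_occ x) M
    have : attractive t U (blockProj Λ M * W) = blockProj Λ M * attractive t U W := by
      simp only [attractive, liebMap, mul_sub, mul_add, mul_smul_comm, Finset.mul_sum,
        ← mul_assoc, hT.eq, (hocc _).eq]
    rw [this, hE, mul_smul_comm]
  · have hc : Commute (num Λ) (blockProj Λ M) := (commute_blockProj (Commute.refl _) M).symm
    rw [mul_assoc, ← hW.eq, ← mul_assoc, ← hc.eq, mul_assoc, h1]

/-- The expansion of the ground states at half filling: in each sector of the numbers of up and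
down electrons there is at most one ground state `φ M`, and its spin-flip correlations have the
sign `ε x * ε y`. -/
lemma exists_groundBasis {ε : Λ → ℂ} (hε : ∀ x, ε x = 1 ∨ ε x = -1) {t : Λ → Λ → ℝ}
    (ht : ∀ x y, t x y = t y x) (hbip : ∀ x y, t x y ≠ 0 → ε x * ε y = -1)
    (connected : IsConnected t) {U E : ℝ} (hU : 0 < U)
    (hmin : ∀ Ψ ∈ sector Λ (Fintype.card Λ),
      E * ‖Ψ‖ ^ 2 ≤ (inner ℂ Ψ (hamiltonian t (fun _ => U) Ψ)).re) :
    ∃ φ : ℕ → Fock Λ, (∀ M : ℕ, φ M ≠ 0 → ‖φ M‖ = 1) ∧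
      (∀ M : ℕ, φ M ∈ energySpace t U E ∧ total Λ 0 0 (φ M) = (M : ℂ) • φ M) ∧
      (∀ M : ℕ, ∀ Ψ ∈ energySpace t U E, total Λ 0 0 Ψ = (M : ℂ) • Ψ → ∃ c : ℂ, Ψ = c • φ M) ∧
      (∀ Ψ ∈ energySpace t U E, ∃ c : ℕ → ℂ,
        Ψ = ∑ M ∈ Finset.range (Fintype.card Λ + 1), c M • φ M) ∧
      (∀ (M : ℕ) (x y : Λ), 0 ≤ ε x * ε y * inner ℂ (φ M) ((transfer x 0 x 1 * transfer y 1 y 0) (φ M))) ∧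
      (∀ (M : ℕ) (x y : Λ), φ M ≠ 0 → 1 ≤ M → M < Fintype.card Λ →
        inner ℂ (φ M) ((transfer x 0 x 1 * transfer y 1 y 0) (φ M)) ≠ 0) := by
  have hH : ∀ Φ Ψ : Fock Λ, inner ℂ (hamiltonian t (fun _ => U) Φ) Ψ =
      inner ℂ Φ (hamiltonian t (fun _ => U) Ψ) := by
    intro Φ Ψ
    rw [← LinearMap.adjoint_inner_left, adjoint_hamiltonian ht]
  have hvar : VariationalPrinciple t U E := by
    intro W hW hle
    obtain ⟨Ψ, rfl⟩ := exists_flip_eq hε W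
    rw [← flip_hamiltonian hε hbip U hW, ← inner_eq_trace_flip hε, ← inner_eq_trace_flip hε,
      inner_self_eq_norm_sq_to_K] at hle
    have hE := eigen_of_minimal hH (fun v hv => hamiltonian_mem_sector hv t _) hmin
      ((mem_sector_iff hε Ψ).2 hW) (by simpa [← Complex.ofReal_pow] using hle)
    rw [← flip_hamiltonian hε hbip U hW, hE, flip_smul]
  have hblock : ∀ (M : ℕ) (Ψ : Fock Λ), IsEigenBlock t U E M (flip ε Ψ) ↔
      Ψ ∈ energySpace t U E ∧ total Λ 0 0 Ψ = (M : ℂ) • Ψ := by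
    intro M Ψ
    rw [mem_energySpace, mem_sector_iff hε, ← (flip_injective hε).eq_iff (b := (M : ℂ) • Ψ),
      flip_total_zero, flip_smul]
    constructor
    · intro h
      have hc : Commute (num Λ) (flip ε Ψ) := h.num_mul.trans h.mul_num.symm
      refine ⟨⟨hc, flip_injective hε ?_⟩, h.num_mul⟩
      rw [flip_hamiltonian hε hbip U hc, h.eigen, flip_smul]
    · rintro ⟨⟨hc, hE⟩, hn⟩
      refine ⟨?_, hn, hc.eq ▸ hn⟩
      rw [← flip_hamiltonian hε hbip U hc, hE, flip_smul]
  choose P hP hPB hPspan using fun M => exists_posSemidef_spanning ht connected hU hvar M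
  choose ψ hψ using fun M => exists_flip_eq hε (P M)
  -- normalization
  have hspan : ∀ (M : ℕ) (Ψ : Fock Λ), Ψ ∈ energySpace t U E → total Λ 0 0 Ψ = (M : ℂ) • Ψ →
      ∃ c : ℂ, Ψ = c • (((‖ψ M‖⁻¹ : ℝ) : ℂ) • ψ M) := by
    intro M Ψ h1 h2
    obtain ⟨c, hc⟩ := hPspan M _ ((hblock M Ψ).2 ⟨h1, h2⟩)
    refine ⟨c * ‖ψ M‖, flip_injective hε ?_⟩
    rw [flip_smul, flip_smul, hψ, hc, smul_smul]
    by_cases h0 : ψ M = 0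
    · rw [← hψ, h0]; simp [flip]
    · have : (‖ψ M‖ : ℂ) ≠ 0 := by simpa using h0
      congr 1
      push_cast
      field_simp
  have hcorr : ∀ (M : ℕ) (x y : Λ) (r : ℝ), ε x * ε y *
      inner ℂ ((r : ℂ) • ψ M) ((transfer x 0 x 1 * transfer y 1 y 0) ((r : ℂ) • ψ M)) =
      ((r ^ 2 : ℝ) : ℂ) * (P M * (cre x * (cre y)ᴴ * P M * (cre x * (cre y)ᴴ)ᴴ)).trace := by
    intro M x y r
    have h2 : ∀ z, ε z * ε z = 1 := fun z => by rcases hε z with h | h <;> simp [h]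
    rw [map_smul, inner_smul_left, inner_smul_right, inner_eq_trace_flip hε, flip_flips hε, hψ,
      mul_smul_comm, trace_smul, (hP M).isHermitian.eq, Complex.conj_ofReal, smul_eq_mul]
    push_cast
    linear_combination ((r : ℂ) ^ 2 * ε y * ε y * (P M * (cre x * (cre y)ᴴ * P M *
      (cre x * (cre y)ᴴ)ᴴ)).trace) * h2 x + ((r : ℂ) ^ 2 * (P M * (cre x * (cre y)ᴴ * P M *
      (cre x * (cre y)ᴴ)ᴴ)).trace) * h2 y
  have hmem : ∀ M : ℕ, (((‖ψ M‖⁻¹ : ℝ) : ℂ) • ψ M) ∈ energySpace t U E ∧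
      total Λ 0 0 (((‖ψ M‖⁻¹ : ℝ) : ℂ) • ψ M) = (M : ℂ) • (((‖ψ M‖⁻¹ : ℝ) : ℂ) • ψ M) := by
    intro M
    rw [← hblock, flip_smul, hψ]
    exact (hPB M).smul _
  refine ⟨fun M => ((‖ψ M‖⁻¹ : ℝ) : ℂ) • ψ M, ?_, hmem, hspan, ?_, ?_, ?_⟩
  · intro M h
    have : ‖ψ M‖ ≠ 0 := by
      intro h0; apply h; simp [h0]
    rw [norm_smul, Complex.norm_real, norm_inv, norm_norm, inv_mul_cancel₀ this]
  · intro Ψ hΨ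
    have hΨ' := mem_energySpace.1 hΨ
    have hc := (mem_sector_iff hε Ψ).1 hΨ'.1
    have hE : attractive t U (flip ε Ψ) = (E : ℂ) • flip ε Ψ := by
      rw [← flip_hamiltonian hε hbip U hc, hΨ'.2, flip_smul]
    have : ∀ M, ∃ c : ℂ, blockProj Λ M * flip ε Ψ =
        c • flip ε (((‖ψ M‖⁻¹ : ℝ) : ℂ) • ψ M) := by
      intro M
      obtain ⟨Ψ', hΨ'⟩ := exists_flip_eq hε (blockProj Λ M * flip ε Ψ)
      have hB := isEigenBlock_blockProj_mul hc hE M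
      rw [← hΨ'] at hB ⊢
      obtain ⟨h1, h2⟩ := (hblock M Ψ').1 hB
      obtain ⟨c, hc⟩ := hspan M Ψ' h1 h2
      exact ⟨c, by rw [← flip_smul, ← hc]⟩
    choose c hc' using this
    refine ⟨c, flip_injective hε ?_⟩
    rw [flip_sum]
    simp only [flip_smul] at hc' ⊢
    simp only [← hc']
    rw [← Finset.sum_mul, sum_blockProj, one_mul]
  · intro M x y
    rw [hcorr]
    exact mul_nonneg (Complex.zero_le_real.mpr (sq_nonneg _)) (trace_sandwich_nonneg (hP M) _)
  · intro M x y h hM1 hM2 h0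
    have hψ0 : ψ M ≠ 0 := by rintro h'; exact h (by simp [h'])
    have hP0 : P M ≠ 0 := by
      intro h'
      apply hψ0
      apply flip_injective hε
      rw [hψ, h']; simp [flip]
    have h1 := hcorr M x y ‖ψ M‖⁻¹
    rw [h0, mul_zero, eq_comm, mul_eq_zero] at h1
    -- a set of `M` sites which contains `x` and, unless `y = x`, does not contain `y`
    obtain ⟨S, hS1, hS2, hS3⟩ := Finset.exists_subsuperset_card_eq
      (s := {x}) (t := Finset.univ \ ({y} \ {x})) (n := M) (by simp) (by simpa using hM1) (by
        have h1 := Finset.le_card_sdiff ({y} \ {x}) (Finset.univ : Finset Λ)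
        have h2 : (({y} \ {x} : Finset Λ)).card ≤ 1 :=
          (Finset.card_le_card Finset.sdiff_subset).trans (by simp)
        rw [Finset.card_univ] at h1
        omega)
    refine (hPB M).trace_sandwich_ne_zero connected hU (hP M) hP0
      (commute_num_cre_mul_ann x y) (S := S) (T := insert y (S.erase x)) hS3 ?_
      (h1.resolve_left (by simpa using hψ0))
    rw [cre_mul_ann_apply, if_pos]
    · exact mul_ne_zero (jwSign_ne_zero _ _) (jwSign_ne_zero _ _)
    · refine ⟨by simpa using hS1, fun hy => ?_, rfl⟩
      have := hS2 (Finset.mem_of_mem_erase hy)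
      simp at this
      exact (Finset.ne_of_mem_erase hy) this

end Hubbard

/-! ### Averaging over the ground states -/

namespace Hubbard

section Rank

variable {F : Type*} [NormedAddCommGroup F] [InnerProductSpace ℂ F]

/-- The operator `∑ i ∈ s, |φ i⟩⟨φ i|`. -/
noncomputable def outerSum {ι : Type*} (s : Finset ι) (φ : ι → F) : Module.End ℂ F :=
  ∑ i ∈ s, (InnerProductSpace.rankOne ℂ (φ i) (φ i)).toLinearMap

lemma outerSum_apply {ι : Type*} (s : Finset ι) (φ : ι → F) (v : F) :
    outerSum s φ v = ∑ i ∈ s, inner ℂ (φ i) v • φ i := by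
  simp [outerSum, LinearMap.sum_apply]

lemma inner_outerSum {ι : Type*} (s : Finset ι) (φ : ι → F) (v w : F) :
    inner ℂ (outerSum s φ v) w = inner ℂ v (outerSum s φ w) := by
  simp only [outerSum_apply, sum_inner, inner_sum, inner_smul_left, inner_smul_right,
    inner_conj_symm]
  exact Finset.sum_congr rfl fun i _ => mul_comm _ _

lemma trace_outerSum_mul [FiniteDimensional ℂ F] {ι : Type*} (s : Finset ι) (φ : ι → F)
    (X : Module.End ℂ F) :
    LinearMap.trace ℂ F (outerSum s φ * X) = ∑ i ∈ s, inner ℂ (φ i) (X (φ i)) := by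
  rw [LinearMap.trace_mul_comm, outerSum, Finset.mul_sum, map_sum]
  refine Finset.sum_congr rfl fun i _ => ?_
  rw [← InnerProductSpace.trace_rankOne]
  congr 1
  ext v
  simp

end Rank

variable {Λ : Type*} [Fintype Λ] [LinearOrder Λ]

/-- A projection onto a space of ground states which is invariant under global spin rotations
commutes with the spin rotations. -/
lemma commute_total_of_invariant {V : Submodule ℂ (Fock Λ)} {P : Module.End ℂ (Fock Λ)}
    (hsymm : ∀ v w, inner ℂ (P v) w = inner ℂ v (P w)) (hmem : ∀ v, P v ∈ V)
    (hfix : ∀ v ∈ V, P v = v) (hV : ∀ σ τ, ∀ v ∈ V, total Λ σ τ v ∈ V) (σ τ : Fin 2) :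
    Commute P (total Λ σ τ) := by
  refine LinearMap.ext fun v => ext_inner_right ℂ fun w => ?_
  rw [Module.End.mul_apply, Module.End.mul_apply, hsymm, ← LinearMap.adjoint_inner_right,
    adjoint_total, ← hfix _ (hV τ σ _ (hmem w)), ← hsymm, ← adjoint_total,
    LinearMap.adjoint_inner_right, ← hsymm, hfix _ (hV σ τ _ (hmem v))]

/-- Under a functional which is invariant under global spin rotations, the spin-flip correlation
determines the full spin correlation. -/
lemma trace_mul_spinDot {P : Module.End ℂ (Fock Λ)} (hP : ∀ σ τ, Commute P (total Λ σ τ))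
    (x y : Λ) :
    LinearMap.trace ℂ _ (P * spinDot x y) =
      (3 / 2) * LinearMap.trace ℂ _ (P * (transfer x 0 x 1 * transfer y 1 y 0)) := by
  have h : ∀ (σ τ : Fin 2) (X : Module.End ℂ (Fock Λ)),
      LinearMap.trace ℂ _ (P * (total Λ σ τ * X - X * total Λ σ τ)) = 0 := by
    intro σ τ X
    rw [mul_sub, map_sub, ← mul_assoc P X, LinearMap.trace_mul_comm ℂ (P * X), ← mul_assoc,
      ← mul_assoc, (hP σ τ).eq, sub_self]
  -- the commutators with `S⁻_x Sᶻ_y` and `S⁺_x Sᶻ_y` relate the three products of components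
  have hpol : ∀ z : Λ, total Λ 0 1 * polarization z - polarization z * total Λ 0 1 =
      (-2 : ℂ) • transfer z 0 z 1 := by
    intro z
    have h1 := total_commutator_transfer z z 0 1 0 0
    have h2 := total_commutator_transfer z z 0 1 1 1
    simp only [if_true, one_ne_zero, zero_ne_one, if_false] at h1 h2
    have : total Λ 0 1 * polarization z - polarization z * total Λ 0 1 =
      (total Λ 0 1 * transfer z 0 z 0 - transfer z 0 z 0 * total Λ 0 1) -
      (total Λ 0 1 * transfer z 1 z 1 - transfer z 1 z 1 * total Λ 0 1) := by
      rw [polarization]; noncomm_ring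
    rw [this, h1, h2]
    module
  have hpol' : ∀ z : Λ, total Λ 1 0 * polarization z - polarization z * total Λ 1 0 =
      (2 : ℂ) • transfer z 1 z 0 := by
    intro z
    have h1 := total_commutator_transfer z z 1 0 0 0
    have h2 := total_commutator_transfer z z 1 0 1 1
    simp only [if_true, one_ne_zero, zero_ne_one, if_false] at h1 h2
    have : total Λ 1 0 * polarization z - polarization z * total Λ 1 0 =
      (total Λ 1 0 * transfer z 0 z 0 - transfer z 0 z 0 * total Λ 1 0) -
      (total Λ 1 0 * transfer z 1 z 1 - transfer z 1 z 1 * total Λ 1 0) := by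
      rw [polarization]; noncomm_ring
    rw [this, h1, h2]
    module
  have e1 := h 0 1 (transfer x 1 x 0 * polarization y)
  have e2 := h 1 0 (transfer x 0 x 1 * polarization y)
  rw [commutator_mul, hpol, total_commutator_transfer] at e1
  rw [commutator_mul, hpol', total_commutator_transfer] at e2
  simp only [if_true, mul_add, mul_smul_comm, map_add, map_smul, smul_eq_mul] at e1 e2
  have hp : transfer x 0 x 0 - transfer x 1 x 1 = polarization x := rfl
  have hp' : transfer x 1 x 1 - transfer x 0 x 0 = -polarization x := by
    rw [polarization]; abel
  rw [hp] at e1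
  rw [hp', neg_mul, mul_neg, map_neg] at e2
  rw [spinDot_eq, mul_add, mul_smul_comm, mul_smul_comm, mul_add, map_add, map_smul, map_smul,
    map_add, smul_eq_mul, smul_eq_mul]
  linear_combination (-1 / 4 : ℂ) * e1 + (-1 / 2 : ℂ) * e2

/-- The lowering and the raising operator change the number of up electrons by one. -/
lemma total_weight {Φ : Fock Λ} {μ : ℂ} (hΦ : total Λ 0 0 Φ = μ • Φ) :
    total Λ 0 0 (total Λ 1 0 Φ) = (μ - 1) • total Λ 1 0 Φ ∧
      total Λ 0 0 (total Λ 0 1 Φ) = (μ + 1) • total Λ 0 1 Φ := by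
  have h1 := congrArg (fun X => X Φ) (total_commutator_total (Λ := Λ) 0 0 1 0)
  have h2 := congrArg (fun X => X Φ) (total_commutator_total (Λ := Λ) 0 0 0 1)
  simp only [if_true, zero_ne_one, if_false, LinearMap.sub_apply,
    Module.End.mul_apply, hΦ, map_smul, LinearMap.zero_apply] at h1 h2
  constructor
  · rw [sub_eq_iff_eq_add.1 h1]; module
  · rw [sub_eq_iff_eq_add.1 h2]; module

/-- This is the commutator of the spin raising and lowering operators in expectation. -/
lemma norm_lower_sq_sub {Φ : Fock Λ} {N : ℕ} (hN : Φ ∈ sector Λ N) {M : ℕ}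
    (hΦ : total Λ 0 0 Φ = (M : ℂ) • Φ) :
    ‖total Λ 1 0 Φ‖ ^ 2 - ‖total Λ 0 1 Φ‖ ^ 2 = (2 * M - N) * ‖Φ‖ ^ 2 := by
  have h1 : total Λ 1 1 Φ = ((N : ℂ) - M) • Φ := by
    rw [sector, LinearMap.mem_ker, LinearMap.sub_apply, sub_eq_zero, totalNumber_eq,
      LinearMap.add_apply, hΦ] at hN
    rw [← sub_eq_of_eq_add' hN.symm]
    simp [sub_smul]
  have h2 := congrArg (fun X => X Φ) (total_commutator_total (Λ := Λ) 0 1 1 0)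
  simp only [if_true, LinearMap.sub_apply, Module.End.mul_apply, hΦ, h1] at h2
  have h3 := congrArg (fun v => inner ℂ Φ v) h2
  simp only [inner_sub_right, inner_smul_right] at h3
  have h5 : ∀ σ τ, inner ℂ Φ (total Λ σ τ (total Λ τ σ Φ)) =
      inner ℂ (total Λ τ σ Φ) (total Λ τ σ Φ) := by
    intro σ τ
    rw [← LinearMap.adjoint_inner_left, adjoint_total]
  rw [h5, h5, inner_self_eq_norm_sq_to_K, inner_self_eq_norm_sq_to_K,
    inner_self_eq_norm_sq_to_K] at h3
  have h4 : ((‖total Λ 1 0 Φ‖ ^ 2 - ‖total Λ 0 1 Φ‖ ^ 2 : ℝ) : ℂ) =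
      (((2 * M - N) * ‖Φ‖ ^ 2 : ℝ) : ℂ) := by
    push_cast
    linear_combination h3
  exact_mod_cast h4

lemma lower_ne_zero {Φ : Fock Λ} {N : ℕ} (hN : Φ ∈ sector Λ N) {M : ℕ}
    (hΦ : total Λ 0 0 Φ = (M : ℂ) • Φ) (h0 : Φ ≠ 0) (hM : N < 2 * M) : total Λ 1 0 Φ ≠ 0 := by
  intro hz
  have h1 := norm_lower_sq_sub hN hΦ
  rw [hz, norm_zero] at h1
  have h2 : (0 : ℝ) < 2 * M - N := by rw [sub_pos]; exact_mod_cast hM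
  have h3 : 0 < (2 * M - N) * ‖Φ‖ ^ 2 := mul_pos h2 (pow_pos (norm_pos_iff.mpr h0) 2)
  nlinarith [sq_nonneg ‖total Λ 0 1 Φ‖]

lemma raise_ne_zero {Φ : Fock Λ} {N : ℕ} (hN : Φ ∈ sector Λ N) {M : ℕ}
    (hΦ : total Λ 0 0 Φ = (M : ℂ) • Φ) (h0 : Φ ≠ 0) (hM : 2 * M < N) : total Λ 0 1 Φ ≠ 0 := by
  intro hz
  have h1 := norm_lower_sq_sub hN hΦ
  rw [hz, norm_zero] at h1
  have h2 : (0 : ℝ) < N - 2 * M := by rw [sub_pos]; exact_mod_cast hM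
  have h3 : 0 < (N - 2 * M) * ‖Φ‖ ^ 2 := mul_pos h2 (pow_pos (norm_pos_iff.mpr h0) 2)
  nlinarith [sq_nonneg ‖total Λ 1 0 Φ‖]

lemma induction_towards {p : ℕ → Prop} {f : ℕ → ℂ} {k : ℕ}
    (hlow : ∀ M, k ≤ M → p (M + 1) → p M ∧ f M = f (M + 1))
    (hup : ∀ M, M < k → p M → p (M + 1) ∧ f (M + 1) = f M) (M : ℕ) (hM : p M) :
    p k ∧ f k = f M := by
  rcases le_total k M with h | h
  · induction M, h using Nat.le_induction with
    | base => exact ⟨hM, rfl⟩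
    | succ M h ih =>
      obtain ⟨h1, h2⟩ := hlow M h hM
      obtain ⟨h3, h4⟩ := ih h1
      exact ⟨h3, h4.trans h2⟩
  · induction h using Nat.decreasingInduction with
    | self => exact ⟨hM, rfl⟩
    | of_succ M h ih =>
      obtain ⟨h1, h2⟩ := hup M h hM
      obtain ⟨h3, h4⟩ := ih h1
      exact ⟨h3, h4.trans h2⟩

/-- Every ground state at half filling has a spin correlation with the sign of `ε x * ε y`. -/
lemma pos_sign_mul_spinDot {ε : Λ → ℂ} (hε : ∀ x, ε x = 1 ∨ ε x = -1) {t : Λ → Λ → ℝ}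
    (ht : ∀ x y, t x y = t y x) (hbip : ∀ x y, t x y ≠ 0 → ε x * ε y = -1)
    (connected : IsConnected t) (heven : Even (Fintype.card Λ)) {U : ℝ} (hU : 0 < U)
    {Φ : Fock Λ} (ground : IsGroundState (hamiltonian t fun _ => U) (Fintype.card Λ) Φ)
    (x y : Λ) : 0 < ε x * ε y * inner ℂ Φ (spinDot x y Φ) := by
  obtain ⟨hsec, hΦ0, E, hE, hmin⟩ := ground
  obtain ⟨φ, hnorm, hφ, hspan, hexp, hnonneg, hne⟩ :=
    exists_groundBasis hε ht hbip connected hU hmin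
  obtain ⟨k, hk⟩ := heven
  have hΦ : Φ ∈ energySpace t U E := mem_energySpace.2 ⟨hsec, hE⟩
  set s := Finset.range (Fintype.card Λ + 1) with hs
  set P := outerSum s φ with hP
  set K := spinDot x y with hK
  -- operators that conserve the number of up electrons have no off-diagonal elements
  have horth : ∀ X : Module.End ℂ (Fock Λ), Commute (total Λ 0 0) X → ∀ M M', M ≠ M' →
      inner ℂ (φ M) (X (φ M')) = 0 := by
    intro X hX M M' hMM'
    have h1 : inner ℂ (total Λ 0 0 (φ M)) (X (φ M')) =
        inner ℂ (φ M) (total Λ 0 0 (X (φ M'))) := by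
      rw [← LinearMap.adjoint_inner_right, adjoint_total]
    rw [← Module.End.mul_apply, hX.eq, Module.End.mul_apply, (hφ M).2, (hφ M').2, map_smul,
      inner_smul_left, inner_smul_right, Complex.conj_natCast, ← sub_eq_zero, ← sub_mul,
      mul_eq_zero, sub_eq_zero] at h1
    exact h1.resolve_left (by exact_mod_cast hMM')
  have hPX : ∀ X : Module.End ℂ (Fock Λ), Commute (total Λ 0 0) X → ∀ M ∈ s,
      P (X (φ M)) = inner ℂ (φ M) (X (φ M)) • φ M := by
    intro X hX M hM
    rw [hP, outerSum_apply, Finset.sum_eq_single M]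
    · intro M' _ hM'
      rw [horth X hX M' M hM', zero_smul]
    · exact fun h => absurd hM h
  have hfixφ : ∀ M ∈ s, P (φ M) = φ M := by
    intro M hM
    have := hPX 1 (Commute.one_right _) M hM
    rw [Module.End.one_apply] at this
    rw [this, inner_self_eq_norm_sq_to_K]
    by_cases h0 : φ M = 0
    · simp [h0]
    · simp [hnorm M h0]
  have hfix : ∀ v ∈ energySpace t U E, P v = v := by
    intro v hv
    obtain ⟨c, hc⟩ := hexp v hv
    rw [hc, map_sum]
    refine Finset.sum_congr rfl fun M hM => ?_
    rw [map_smul, hfixφ M hM]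
  have hmem : ∀ v, P v ∈ energySpace t U E := by
    intro v
    rw [hP, outerSum_apply]
    exact Submodule.sum_mem _ fun M _ => Submodule.smul_mem _ _ (hφ M).1
  have hcomm : ∀ σ τ, Commute P (total Λ σ τ) :=
    commute_total_of_invariant (inner_outerSum s φ) hmem hfix
      fun σ τ v hv => total_mem_energySpace hv σ τ
  -- the spin raising and lowering operators carry the correlation from one sector to the next
  have hstep : ∀ M ∈ s, ∀ M' ∈ s, ∀ σ τ, total Λ σ τ (φ M) ≠ 0 →
      total Λ 0 0 (total Λ σ τ (φ M)) = (M' : ℂ) • total Λ σ τ (φ M) →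
      φ M' ≠ 0 ∧ inner ℂ (φ M') (K (φ M')) = inner ℂ (φ M) (K (φ M)) := by
    intro M hM M' hM' σ τ h0 hw
    obtain ⟨c, hc⟩ := hspan M' _ (total_mem_energySpace (hφ M).1 σ τ) hw
    have hc0 : c • φ M' ≠ 0 := hc ▸ h0
    refine ⟨right_ne_zero_of_smul hc0, ?_⟩
    have h1 : P (K (total Λ σ τ (φ M))) = total Λ σ τ (P (K (φ M))) := by
      simp only [← Module.End.mul_apply]
      rw [hK, ← (commute_total_spinDot x y σ τ).eq, ← mul_assoc, (hcomm σ τ).eq, mul_assoc]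
    rw [hPX K (commute_total_spinDot x y 0 0) M hM, map_smul, hc, map_smul, map_smul,
      hPX K (commute_total_spinDot x y 0 0) M' hM', smul_comm, ← sub_eq_zero, ← sub_smul,
      smul_eq_zero, sub_eq_zero] at h1
    exact h1.resolve_right hc0
  set κ : ℂ := inner ℂ (φ k) (K (φ k)) with hκ
  have hall : ∀ M ∈ s, φ M ≠ 0 → φ k ≠ 0 ∧ κ = inner ℂ (φ M) (K (φ M)) := by
    intro M hM h0
    have := induction_towards (p := fun M => M ∈ s ∧ φ M ≠ 0)
      (f := fun M => inner ℂ (φ M) (K (φ M))) (k := k) ?_ ?_ M ⟨hM, h0⟩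
    · exact ⟨this.1.2, this.2⟩
    · rintro M h ⟨hM, h0⟩
      have hM' : M ∈ s := by rw [hs, Finset.mem_range] at hM ⊢; omega
      have h1 := (total_weight (hφ (M + 1)).2).1
      have e : ((M + 1 : ℕ) : ℂ) - 1 = M := by push_cast; ring
      rw [e] at h1
      obtain ⟨h2, h3⟩ := hstep _ hM _ hM' 1 0
        (lower_ne_zero (mem_energySpace.1 (hφ _).1).1 (hφ _).2 h0 (by omega)) h1
      exact ⟨⟨hM', h2⟩, h3⟩
    · rintro M h ⟨hM, h0⟩
      have hM' : M + 1 ∈ s := by rw [hs, Finset.mem_range]; omega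
      have h1 := (total_weight (hφ M).2).2
      have e : (M : ℂ) + 1 = ((M + 1 : ℕ) : ℂ) := by push_cast; ring
      rw [e] at h1
      obtain ⟨h2, h3⟩ := hstep _ hM _ hM' 0 1
        (raise_ne_zero (mem_energySpace.1 (hφ _).1).1 (hφ _).2 h0 (by omega)) h1
      exact ⟨⟨hM', h2⟩, h3⟩
  have hkφ : φ k ≠ 0 := by
    obtain ⟨c, hc⟩ := hexp Φ hΦ
    by_contra h
    apply hΦ0
    rw [hc]
    refine Finset.sum_eq_zero fun M hM => ?_
    by_contra h'
    exact (hall M hM (right_ne_zero_of_smul h')).1 h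
  have hdiag : ∀ M ∈ s, inner ℂ (φ M) (K (φ M)) = κ * ((‖φ M‖ ^ 2 : ℝ) : ℂ) := by
    intro M hM
    by_cases h0 : φ M = 0
    · simp [h0]
    · rw [← (hall M hM h0).2, hnorm M h0]; simp
  -- the compression of the correlation to the ground states is the scalar `κ`
  have hPK : P (K Φ) = κ • Φ := by
    obtain ⟨c, hc⟩ := hexp Φ hΦ
    rw [hc, map_sum, map_sum, Finset.smul_sum]
    refine Finset.sum_congr rfl fun M hM => ?_
    rw [map_smul, map_smul, hPX K (commute_total_spinDot x y 0 0) M hM, smul_comm]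
    by_cases h0 : φ M = 0
    · simp [h0]
    · rw [(hall M hM h0).2]
  have hval : inner ℂ Φ (K Φ) = κ * ((‖Φ‖ ^ 2 : ℝ) : ℂ) := by
    have : inner ℂ Φ (K Φ) = inner ℂ Φ (P (K Φ)) := by
      rw [← inner_outerSum s φ, ← hP, hfix Φ hΦ]
    rw [this, hPK, inner_smul_right, inner_self_eq_norm_sq_to_K]
    push_cast
    rfl
  -- the average over the ground states
  have htr := trace_mul_spinDot hcomm x y
  rw [hP, trace_outerSum_mul, trace_outerSum_mul, ← hK, Finset.sum_congr rfl hdiag,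
    ← Finset.mul_sum, ← Complex.ofReal_sum] at htr
  have hks : k ∈ s := by rw [hs, Finset.mem_range]; omega
  have hk1 : 1 ≤ k := by
    have := Fintype.card_pos_iff.2 ⟨x⟩
    omega
  set D : ℝ := ∑ M ∈ s, ‖φ M‖ ^ 2 with hD
  have hDpos : 0 < D := by
    refine Finset.sum_pos' (fun M _ => sq_nonneg _) ⟨k, hks, ?_⟩
    rw [hnorm k hkφ]; norm_num
  have hRpos : 0 < ∑ M ∈ s, ε x * ε y *
      inner ℂ (φ M) ((transfer x 0 x 1 * transfer y 1 y 0) (φ M)) := by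
    refine Finset.sum_pos' (fun M _ => hnonneg M x y) ⟨k, hks, ?_⟩
    refine lt_of_le_of_ne (hnonneg k x y) (Ne.symm (mul_ne_zero ?_ ?_))
    · rcases hε x with h | h <;> rcases hε y with h' | h' <;> simp [h, h']
    · exact hne k x y hkφ hk1 (by omega)
  have hκpos : 0 < ε x * ε y * κ := by
    have h1 : ε x * ε y * κ = (3 / 2 : ℂ) * (∑ M ∈ s, ε x * ε y *
        inner ℂ (φ M) ((transfer x 0 x 1 * transfer y 1 y 0) (φ M))) * ((D⁻¹ : ℝ) : ℂ) := by
      have hD0 : (D : ℂ) ≠ 0 := by exact_mod_cast hDpos.ne'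
      rw [← Finset.mul_sum]
      push_cast
      field_simp
      linear_combination (2 * ε x * ε y) * htr
    rw [h1]
    refine mul_pos (mul_pos ?_ hRpos) (Complex.zero_lt_real.mpr (inv_pos.mpr hDpos))
    have : (3 / 2 : ℂ) = ((3 / 2 : ℝ) : ℂ) := by push_cast; rfl
    rw [this]
    exact Complex.zero_lt_real.mpr (by norm_num)
  rw [hval, ← mul_assoc]
  exact mul_pos hκpos (Complex.zero_lt_real.mpr (by positivity))

end Hubbard

theorem mainTheorem9 {Λ : Type*} [Fintype Λ] [LinearOrder Λ]
    (t : Λ → Λ → ℝ) (t_symm : ∀ x y, t x y = t y x)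
    (A B : Finset Λ) (bipartite : Hubbard.IsBipartite t A B)
    (card_even : Even (Fintype.card Λ)) (connected : Hubbard.IsConnected t)
    (U : ℝ) (U_pos : 0 < U)
    (Φ : Hubbard.Fock Λ)
    (ground : Hubbard.IsGroundState (Hubbard.hamiltonian t (fun _ => U)) (Fintype.card Λ) Φ)
    (x y : Λ) :
    (((x ∈ A ∧ y ∈ A) ∨ (x ∈ B ∧ y ∈ B)) → 0 < inner ℂ Φ (Hubbard.spinDot x y Φ)) ∧
    (((x ∈ A ∧ y ∈ B) ∨ (x ∈ B ∧ y ∈ A)) → inner ℂ Φ (Hubbard.spinDot x y Φ) < 0) := by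
  obtain ⟨hAB, hdisj, hA, hB⟩ := bipartite
  have hBA : ∀ z, z ∈ B ↔ z ∉ A := by
    intro z
    refine ⟨fun h h' => Finset.disjoint_left.mp hdisj h' h, fun h => ?_⟩
    have : z ∈ A ∪ B := hAB ▸ Finset.mem_univ z
    exact (Finset.mem_union.mp this).resolve_left h
  have main := Hubbard.pos_sign_mul_spinDot (ε := fun z => if z ∈ A then 1 else -1)
    (fun z => by by_cases h : z ∈ A <;> simp [h]) t_symm
    (fun u v huv => by
      by_cases hu : u ∈ A <;> by_cases hv : v ∈ A
      · exact absurd (hA u hu v hv) huv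
      · simp [hu, hv]
      · simp [hu, hv]
      · exact absurd (hB u ((hBA u).2 hu) v ((hBA v).2 hv)) huv)
    connected card_even U_pos ground x y
  simp only [hBA]
  constructor
  · rintro (⟨hx, hy⟩ | ⟨hx, hy⟩) <;> simpa [hx, hy] using main
  · rintro (⟨hx, hy⟩ | ⟨hx, hy⟩) <;> simpa [hx, hy] using main
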